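/- Consider a spatially homogeneous spacetime with a group-invariant orthonormal frame $\{e_0,e_1,e_2,e_3\}$, where $e_0$ is the unit normal to the group orbits, $[e_0,e_\beta]=-\sum_\alpha\bigl(H\delta_{\alpha\beta}+\sigma_{\alpha\beta}-\epsilon_{\alpha\beta\mu}\Omega_\mu\bigr)e_\alpha$ and $[e_\beta,e_\gamma]=\sum_{\alpha,\delta}\epsilon_{\beta\gamma\delta}n_{\delta\alpha}e_\alpha$; here $\sigma$ is symmetric and trace-free, $n$ is symmetric, and all coefficients depend only on time. Assume Bianchi type VII$_0$ with $e_1$ along the kernel of $n$, i.e. $n_{1\alpha}=0$ and $n_{22}n_{33}-n_{23}^2>0$, and assume $H>0$. Let the Einstein equations $R_{ab}-\tfrac12 R g_{ab}=T_{ab}$ hold, with $\Lambda=0$ and $T_{ab}$ the energy-momentum tensor of a radiation fluid ($p=\tfrac13\times$ energy density in the fluid rest frame) with 4-velocity $u=(e_0+v^\alpha e_\alpha)/\sqrt{1-v_\alpha v^\alpha}$, $v_\alpha v^\alpha<1$, that is irrotational ($u_{[a}\nabla_b u_{c]}=0$). Use the time $\tau$ with $dt/d\tau=1/H$, where $t$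 is clock time along $e_0$, and suppose that the solution exists for all $\tau>\tau_0$. Put $\Omega=T(e_0,e_0)/(3H^2)$, $\Sigma_{\alpha\beta}=\sigma_{\alpha\beta}/H$, $N_{\alpha\beta}=n_{\alpha\beta}/H$, $$\Sigma_-=\tfrac{\Sigma_{22}-\Sigma_{33}}{2\sqrt3},\quad \Sigma_\times=\tfrac{\Sigma_{23}}{\sqrt3},\quad N_+=\tfrac{N_{22}+N_{33}}2,\quad N_-=\tfrac{N_{22}-N_{33}}{2\sqrt3},\quad N_\times=\tfrac{N_{23}}{\sqrt3},\quad M=\tfrac1{N_+},$$ $$\mathcal R_1=\Sigma_-^2+\Sigma_\times^2+N_-^2+N_\times^2,\quad \mathcal R_2(\cos2\psi,\sin2\psi)=\bigl(\Sigma_-^2+\Sigma_\times^2-N_-^2-N_\times^2,\;2(\Sigma_-N_-+\Sigma_\times N_\times)\bigr),$$ $$\Sigma=\sqrt{\tfrac16\Sigma_{\alpha\beta}\Sigma^{\alpha\beta}},\qquad \mathcal W_1=\frac{C_{abcd}C^{abcd}}{48H^4},\qquad \mathcal W_2=\frac{C_{abcd}{}^*C^{abcd}}{48H^4},$$ where $C_{abcd}$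 is the Weyl tensor and ${}^*C_{abcd}=\tfrac12\eta_{ab}{}^{ef}C_{efcd}$ with $\eta^{0123}=1$. Suppose that $\Omega>0$, $\mathcal R_1>0$, $\mathcal R_2>0$ and $v_1>0$ for all $\tau>\tau_0$. Then, as $\tau\to+\infty$, $$\Omega\to1,\qquad v_\alpha\to0,\qquad \Sigma\to0,\qquad M\to0,\qquad \frac{\mathcal R_2}{M^2}\to+\infty .$$ If, moreover, $\mathcal R_2/\mathcal R_1$ does not tend to $0$ (which is the general case), then $$(\mathcal W_1,\mathcal W_2)=-\frac{4\mathcal R_2}{M^2}\bigl[(\cos2\psi,\sin2\psi)+\mathcal O(M)\bigr]\qquad(\tau\to+\infty),$$ and hence $\sqrt{\mathcal W_1^2+\mathcal W_2^2}\to+\infty$. Thus the models isotropize with respect to the shear but, in the general case, not with respect to the Weyl curvature. -/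

import Mathlib

open Filter Topology Asymptotics

noncomputable section

/-- The data of a spatially homogeneous cosmology of Bianchi class A with a tilted fluid, relative
to a group-invariant orthonormal frame `e₀, e₁, e₂, e₃` whose `e₀` is the unit normal to the group
orbits. Every quantity is a function of the dimensionless time `τ`, related to clock time `t`
along `e₀` by `dt/dτ = 1/H`. The spatial indices `1, 2, 3` are `0, 1, 2 : Fin 3`. -/
structure BianchiModel where
  /-- Hubble scalar -/
  H : ℝ → ℝ
  /-- rate of shear tensor -/
  σ : ℝ → Matrix (Fin 3) (Fin 3) ℝ
  /-- spatial curvature variables -/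
  n : ℝ → Matrix (Fin 3) (Fin 3) ℝ
  /-- angular velocity of the spatial frame -/
  ω : ℝ → Fin 3 → ℝ
  /-- energy density of the fluid in its rest frame -/
  μ : ℝ → ℝ
  /-- tilt vector of the fluid -/
  v : ℝ → Fin 3 → ℝ

namespace BianchiModel

/-- The alternating symbol on three indices, with `eps3 0 1 2 = 1`. -/
def eps3 (i j k : Fin 3) : ℝ :=
  (((j : ℕ) : ℝ) - (i : ℕ)) * (((k : ℕ) : ℝ) - (i : ℕ)) * (((k : ℕ) : ℝ) - (j : ℕ)) / 2

/-- The alternating symbol on four indices, with `eps4 0 1 2 3 = 1`. -/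
def eps4 (a b c d : Fin 4) : ℝ :=
  (((b : ℕ) : ℝ) - (a : ℕ)) * (((c : ℕ) : ℝ) - (a : ℕ)) * (((d : ℕ) : ℝ) - (a : ℕ)) *
    (((c : ℕ) : ℝ) - (b : ℕ)) * (((d : ℕ) : ℝ) - (b : ℕ)) * (((d : ℕ) : ℝ) - (c : ℕ)) / 12

/-- Diagonal entries of the metric in an orthonormal frame. -/
def sgn (a : Fin 4) : ℝ := Fin.cases (-1) (fun _ => 1) a

/-- Metric components in an orthonormal frame. -/
def g (a b : Fin 4) : ℝ := if a = b then sgn a else 0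

variable (B : BianchiModel)

/-- The coefficient of `e_α` in `[e₀, e_β]`. -/
def timeComm (τ : ℝ) (α β : Fin 3) : ℝ :=
  -((if α = β then B.H τ else 0) + B.σ τ α β - ∑ μ, eps3 α β μ * B.ω τ μ)

/-- The coefficient of `e_α` in `[e_β, e_γ]` (class A). -/
def spaceComm (τ : ℝ) (α β γ : Fin 3) : ℝ := ∑ δ, eps3 β γ δ * B.n τ δ α

/-- Commutation functions: `[e_a, e_b] = ∑ c, comm τ c a b • e_c`. -/
def comm (τ : ℝ) (c a b : Fin 4) : ℝ :=
  Fin.cases 0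
    (fun α => Fin.cases
      (Fin.cases 0 (fun β => B.timeComm τ α β) b)
      (fun β => Fin.cases (-B.timeComm τ α β) (fun γ => B.spaceComm τ α β γ) b) a) c

/-- The derivative of a function of time along `e_a`: `e₀ = d/dt = H d/dτ`, and the spatial frame
vectors are tangent to the group orbits. -/
def frameDeriv (a : Fin 4) (f : ℝ → ℝ) (τ : ℝ) : ℝ :=
  if a = 0 then B.H τ * deriv f τ else 0

/-- The Jacobi identities `[e_a, [e_b, e_c]] + cyclic = 0`. -/
def Jacobi (τ : ℝ) : Prop :=
  ∀ a b c d : Fin 4,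
    (B.frameDeriv a (fun s => B.comm s d b c) τ + ∑ f, B.comm τ f b c * B.comm τ d a f) +
    (B.frameDeriv b (fun s => B.comm s d c a) τ + ∑ f, B.comm τ f c a * B.comm τ d b f) +
    (B.frameDeriv c (fun s => B.comm s d a b) τ + ∑ f, B.comm τ f a b * B.comm τ d c f) = 0

/-- Levi-Civita connection, `∇_{e_a} e_b = ∑ c, conn τ c a b • e_c`, by the Koszul formula. -/
def conn (τ : ℝ) (c a b : Fin 4) : ℝ :=
  sgn c * ((sgn c * B.comm τ c a b - sgn a * B.comm τ a b c + sgn b * B.comm τ b c a) / 2)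

/-- Riemann tensor `R^a_{bcd}`: the coefficient of `e_a` in
`∇_{e_c} ∇_{e_d} e_b - ∇_{e_d} ∇_{e_c} e_b - ∇_{[e_c, e_d]} e_b`. -/
def riem (τ : ℝ) (a b c d : Fin 4) : ℝ :=
  B.frameDeriv c (fun s => B.conn s a d b) τ - B.frameDeriv d (fun s => B.conn s a c b) τ +
    ∑ f, (B.conn τ f d b * B.conn τ a c f - B.conn τ f c b * B.conn τ a d f -
      B.comm τ f c d * B.conn τ a f b)

/-- Ricci tensor. -/
def ricci (τ : ℝ) (b d : Fin 4) : ℝ := ∑ a, B.riem τ a b a d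

/-- Scalar curvature. -/
def scalar (τ : ℝ) : ℝ := ∑ a, sgn a * B.ricci τ a a

/-- Weyl tensor `C_{abcd}`. -/
def weyl (τ : ℝ) (a b c d : Fin 4) : ℝ :=
  sgn a * B.riem τ a b c d -
    (g a c * B.ricci τ b d - g a d * B.ricci τ b c +
      g b d * B.ricci τ a c - g b c * B.ricci τ a d) / 2 +
    B.scalar τ / 6 * (g a c * g b d - g a d * g b c)

/-- Dual Weyl tensor `*C_{abcd} = ½ η_{ab}^{ef} C_{efcd}`, where `η_{abcd}` is the volume form
normalized by `η^{0123} = 1`, that is `η_{0123} = -1`. -/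
def weylDual (τ : ℝ) (a b c d : Fin 4) : ℝ :=
  (∑ e, ∑ f, -eps4 a b e f * sgn e * sgn f * B.weyl τ e f c d) / 2

/-- The covariant components `u_a` of the fluid velocity `u = (n + v) / √(1 - v_α v^α)`. -/
def u (τ : ℝ) (a : Fin 4) : ℝ :=
  Fin.cases (-1) (fun α => B.v τ α) a / √(1 - ∑ α, B.v τ α ^ 2)

/-- Covariant derivative `∇_a u_b`. -/
def covU (τ : ℝ) (a b : Fin 4) : ℝ :=
  B.frameDeriv a (fun s => B.u s b) τ - ∑ c, B.conn τ c a b * B.u τ c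

/-- Vanishing vorticity of the fluid: `u_{[a} ∇_b u_{c]} = 0`. -/
def Irrotational (τ : ℝ) : Prop :=
  ∀ a b c : Fin 4,
    B.u τ a * (B.covU τ b c - B.covU τ c b) + B.u τ b * (B.covU τ c a - B.covU τ a c) +
      B.u τ c * (B.covU τ a b - B.covU τ b a) = 0

/-- Energy-momentum tensor of a perfect fluid with the radiation equation of state
`p = μ / 3`. -/
def stress (τ : ℝ) (a b : Fin 4) : ℝ :=
  B.μ τ * B.u τ a * B.u τ b + B.μ τ / 3 * (g a b + B.u τ a * B.u τ b)

/-- Einstein field equations with zero cosmological constant, in units with `8πG = c = 1`. -/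
def Einstein (τ : ℝ) : Prop :=
  ∀ a b : Fin 4, B.ricci τ a b - B.scalar τ / 2 * g a b = B.stress τ a b

/-- The model is an irrotational radiation-filled cosmology of Bianchi type VII₀ for `τ > τ₀`,
expanding (`H > 0`), with the frame vector `e₁` in the kernel of `n`; type VII₀ means that the
other two eigenvalues of `n` are non-zero and of the same sign. -/
structure IsRadiationVII0 (τ₀ : ℝ) : Prop where
  H_pos : ∀ τ > τ₀, 0 < B.H τ
  H_diff : ∀ τ > τ₀, DifferentiableAt ℝ B.H τ
  σ_diff : ∀ τ > τ₀, ∀ i j, DifferentiableAt ℝ (fun s => B.σ s i j) τ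
  n_diff : ∀ τ > τ₀, ∀ i j, DifferentiableAt ℝ (fun s => B.n s i j) τ
  μ_diff : ∀ τ > τ₀, DifferentiableAt ℝ B.μ τ
  v_diff : ∀ τ > τ₀, ∀ i, DifferentiableAt ℝ (fun s => B.v s i) τ
  σ_symm : ∀ τ > τ₀, (B.σ τ).IsSymm
  σ_trace : ∀ τ > τ₀, (B.σ τ).trace = 0
  n_symm : ∀ τ > τ₀, (B.n τ).IsSymm
  n_ker : ∀ τ > τ₀, ∀ j, B.n τ 0 j = 0
  typeVII : ∀ τ > τ₀, 0 < B.n τ 1 1 * B.n τ 2 2 - B.n τ 1 2 ^ 2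
  v_lt_one : ∀ τ > τ₀, ∑ α, B.v τ α ^ 2 < 1
  jacobi : ∀ τ > τ₀, B.Jacobi τ
  einstein : ∀ τ > τ₀, B.Einstein τ
  irrotational : ∀ τ > τ₀, B.Irrotational τ

/-- Density parameter `Ω = ρ / (3 H²)`, where `ρ = T(e₀, e₀)`. -/
def Ω (τ : ℝ) : ℝ := B.stress τ 0 0 / (3 * B.H τ ^ 2)

/-- Hubble-normalized shear `Σ_{αβ} = σ_{αβ} / H`. -/
def Sh (τ : ℝ) (i j : Fin 3) : ℝ := B.σ τ i j / B.H τ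

/-- Hubble-normalized spatial curvature `N_{αβ} = n_{αβ} / H`. -/
def N (τ : ℝ) (i j : Fin 3) : ℝ := B.n τ i j / B.H τ

/-- `Σ₋`, where `Σ₂₂ = Σ₊ + √3 Σ₋` and `Σ₃₃ = Σ₊ - √3 Σ₋`. -/
def Sm (τ : ℝ) : ℝ := (B.Sh τ 1 1 - B.Sh τ 2 2) / (2 * √3)

/-- `Σ_×`, where `Σ₂₃ = √3 Σ_×`. -/
def Sx (τ : ℝ) : ℝ := B.Sh τ 1 2 / √3

/-- `N₊`, where `N₂₂ = N₊ + √3 N₋` and `N₃₃ = N₊ - √3 N₋`. -/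
def Np (τ : ℝ) : ℝ := (B.N τ 1 1 + B.N τ 2 2) / 2

/-- `N₋`. -/
def Nm (τ : ℝ) : ℝ := (B.N τ 1 1 - B.N τ 2 2) / (2 * √3)

/-- `N_×`, where `N₂₃ = √3 N_×`. -/
def Nx (τ : ℝ) : ℝ := B.N τ 1 2 / √3

/-- `M = 1 / N₊`. -/
def M (τ : ℝ) : ℝ := 1 / B.Np τ

/-- `𝓡₁ = Σ₋² + Σ_×² + N₋² + N_×²`. -/
def R1 (τ : ℝ) : ℝ := B.Sm τ ^ 2 + B.Sx τ ^ 2 + B.Nm τ ^ 2 + B.Nx τ ^ 2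

/-- `𝓡₂` and the angle `ψ` are polar coordinates `(𝓡₂, 2ψ)` of the rotation-invariant pair
`(Σ₋² + Σ_×² - N₋² - N_×², 2 (Σ₋ N₋ + Σ_× N_×))`. -/
def IsPolar (R2 ψ : ℝ → ℝ) (τ : ℝ) : Prop :=
  R2 τ * Real.cos (2 * ψ τ) = B.Sm τ ^ 2 + B.Sx τ ^ 2 - B.Nm τ ^ 2 - B.Nx τ ^ 2 ∧
  R2 τ * Real.sin (2 * ψ τ) = 2 * (B.Sm τ * B.Nm τ + B.Sx τ * B.Nx τ)

/-- Shear parameter, `Σ² = σ_{αβ} σ^{αβ} / (6 H²)`. -/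
def shear (τ : ℝ) : ℝ := √((∑ i, ∑ j, B.σ τ i j ^ 2) / (6 * B.H τ ^ 2))

/-- Weyl parameter `𝓦₁ = C_{abcd} C^{abcd} / (48 H⁴)`. -/
def W1 (τ : ℝ) : ℝ :=
  (∑ a, ∑ b, ∑ c, ∑ d, sgn a * sgn b * sgn c * sgn d * B.weyl τ a b c d * B.weyl τ a b c d) /
    (48 * B.H τ ^ 4)

/-- Weyl parameter `𝓦₂ = C_{abcd} *C^{abcd} / (48 H⁴)`. -/
def W2 (τ : ℝ) : ℝ :=
  (∑ a, ∑ b, ∑ c, ∑ d, sgn a * sgn b * sgn c * sgn d * B.weyl τ a b c d * B.weylDual τ a b c d) /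
    (48 * B.H τ ^ 4)

end BianchiModel

end

/-!
Irrotationality and the momentum constraints force the fluid to move along `e₁`. The quantities that
do not depend on the rotation of the frame about `e₁` then obey a closed system for `x = Σ₊`,
`R = 𝓡₁`, the pair `(A, C) = 𝓡₂ (cos 2ψ, sin 2ψ)`, `X = Σ_× N₋ - Σ₋ N_×`, `N₊` and `v₁`, in which
`(A, C)` turns with angular velocity `4 N₊`.

A monotone function built from `det N` and the conserved particle number makes `M = 1 / N₊` decay
exponentially. Correcting a function of the flow by a multiple of `C / N₊` therefore removes the
oscillating `A` from its derivative at the cost of an integrable error. The number density corrected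
in this way has derivative `2 x²`, so that `x → 0`; the tilt satisfies `y' ≤ -c y²` up to such
corrections, so that `v → 0`; and `R / X` converges, so that `R → 0`.

As `R² = 𝓡₂² + 4 X²`, the ratio `𝓡₂ / R` converges as well. If its limit is positive, then `𝓡₂ / M²`
grows at least like `X / M²`. If its limit is zero, then `R / X → 2`, and `(A, C) / X` is a fast
oscillator forced at order `M`. Subtracting the drift `-(1 + x) (R / X) M / 2` of `C / X` leaves an
oscillator whose amplitude is at most `M / 4`, so that `𝓡₂ / X ≥ M / 2` and `𝓡₂ / M²` grows at least
like `X / M`. Both bounds diverge since `X / M` does.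

In the Weyl tensor the terms of highest order in `N₊` are the transverse trace-free components, with
the electric and magnetic parts proportional to `N₊ (N₋, N_×)` and `N₊ (Σ₋, Σ_×)`. This gives
`𝓦₁ + i 𝓦₂ = -4 N₊² 𝓡₂ exp (2 i ψ)` up to terms of order `N₊ 𝓡₁`.
-/

section Calculus

variable {f f' : ℝ → ℝ}

lemma eventually_monotoneOn_Ici (hf : ∀ᶠ t in atTop, HasDerivAt f (f' t) t)
    (hf' : ∀ᶠ t in atTop, 0 ≤ f' t) : ∀ᶠ T in atTop, MonotoneOn f (Set.Ici T) := by
  filter_upwards [eventually_forall_ge_atTop.2 (hf.and hf')] with T hT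
  exact monotoneOn_of_hasDerivWithinAt_nonneg (convex_Ici T)
    (fun t ht => (hT t ht).1.continuousAt.continuousWithinAt)
    (fun t ht => (hT t (interior_subset ht)).1.hasDerivWithinAt)
    (fun t ht => (hT t (interior_subset ht)).2)

lemma exists_eventually_ge_of_deriv_nonneg (hf : ∀ᶠ t in atTop, HasDerivAt f (f' t) t)
    (hf' : ∀ᶠ t in atTop, 0 ≤ f' t) : ∃ a, ∀ᶠ t in atTop, a ≤ f t := by
  obtain ⟨T, hT⟩ := (eventually_monotoneOn_Ici hf hf').exists
  exact ⟨f T, (eventually_ge_atTop T).mono fun t ht => hT Set.self_mem_Ici ht ht⟩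

lemma exists_tendsto_of_deriv_nonneg {b : ℝ} (hf : ∀ᶠ t in atTop, HasDerivAt f (f' t) t)
    (hf' : ∀ᶠ t in atTop, 0 ≤ f' t) (hb : ∀ᶠ t in atTop, f t ≤ b) :
    ∃ l, Tendsto f atTop (𝓝 l) := by
  obtain ⟨T, hmono, hb⟩ := ((eventually_monotoneOn_Ici hf hf').and
    (eventually_forall_ge_atTop.2 hb)).exists
  have hmax : Monotone fun t => f (max T t) := fun s t hst =>
    hmono (le_max_left T s) (le_max_left T t) (max_le_max le_rfl hst)
  have hbdd : BddAbove (Set.range fun t => f (max T t)) :=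
    ⟨b, Set.forall_mem_range.2 fun t => hb _ (le_max_left T t)⟩
  refine ⟨_, (tendsto_atTop_ciSup hmax hbdd).congr' ?_⟩
  filter_upwards [eventually_ge_atTop T] with t ht
  rw [max_eq_right ht]

lemma exists_linear_le_of_le_deriv {c : ℝ} (hf : ∀ᶠ t in atTop, HasDerivAt f (f' t) t)
    (hf' : ∀ᶠ t in atTop, c ≤ f' t) : ∃ a, ∀ᶠ t in atTop, c * t + a ≤ f t := by
  obtain ⟨a, ha⟩ := exists_eventually_ge_of_deriv_nonneg
    (hf.mono fun t ht => ht.fun_sub ((hasDerivAt_id t).const_mul c))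
    (hf'.mono fun t ht => by rwa [mul_one, sub_nonneg])
  exact ⟨a, ha.mono fun t ht => by simp only [id] at ht; linarith⟩

lemma tendsto_atTop_of_le_deriv {c : ℝ} (hc : 0 < c)
    (hf : ∀ᶠ t in atTop, HasDerivAt f (f' t) t) (hf' : ∀ᶠ t in atTop, c ≤ f' t) :
    Tendsto f atTop atTop := by
  obtain ⟨a, ha⟩ := exists_linear_le_of_le_deriv hf hf'
  exact tendsto_atTop_mono' _ ha
    (tendsto_atTop_add_const_right _ a (tendsto_id.const_mul_atTop hc))

lemma exists_tendsto_of_abs_deriv_le {L L' : ℝ → ℝ} {l : ℝ}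
    (hf : ∀ᶠ t in atTop, HasDerivAt f (f' t) t) (hL : ∀ᶠ t in atTop, HasDerivAt L (L' t) t)
    (hle : ∀ᶠ t in atTop, |f' t| ≤ L' t) (hlim : Tendsto L atTop (𝓝 l)) :
    ∃ a, Tendsto f atTop (𝓝 a) := by
  obtain ⟨c, hc⟩ := exists_eventually_ge_of_deriv_nonneg
    (hL.mp (hf.mono fun t h₁ h₂ => h₂.fun_sub h₁))
    (hle.mono fun t ht => sub_nonneg.2 ((le_abs_self _).trans ht))
  obtain ⟨a, ha⟩ := exists_tendsto_of_deriv_nonneg (b := 2 * (l + 1) - c)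
    (hL.mp (hf.mono fun t h₁ h₂ => h₂.fun_add h₁))
    (hle.mono fun t ht => by linarith [neg_abs_le (f' t)])
    (by filter_upwards [hc, hlim.eventually_lt_const (lt_add_one l)] with t h₁ h₂; linarith)
  exact ⟨a - l, (ha.sub hlim).congr fun t => add_sub_cancel_left _ _⟩

lemma hasDerivAt_neg_exp_div {κ : ℝ} (hκ : κ ≠ 0) (b t : ℝ) :
    HasDerivAt (fun s => -(b / κ * Real.exp (-κ * s))) (b * Real.exp (-κ * t)) t := by
  refine ((((hasDerivAt_id t).const_mul (-κ)).exp).const_mul (b / κ)).fun_neg.congr_deriv ?_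
  simp only [id, mul_one]
  field_simp

lemma tendsto_exp_neg_mul {κ : ℝ} (hκ : 0 < κ) :
    Tendsto (fun s => Real.exp (-κ * s)) atTop (𝓝 0) :=
  Real.tendsto_exp_atBot.comp (tendsto_id.const_mul_atTop_of_neg (neg_neg_of_pos hκ))

lemma tendsto_neg_exp_div {κ : ℝ} (hκ : 0 < κ) (b : ℝ) :
    Tendsto (fun s => -(b / κ * Real.exp (-κ * s))) atTop (𝓝 0) := by
  simpa using ((tendsto_exp_neg_mul hκ).const_mul (b / κ)).neg

lemma exists_tendsto_of_deriv_isBigO_exp {κ : ℝ} (hκ : 0 < κ)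
    (hf : ∀ᶠ t in atTop, HasDerivAt f (f' t) t)
    (hf' : f' =O[atTop] fun t => Real.exp (-κ * t)) : ∃ a, Tendsto f atTop (𝓝 a) := by
  obtain ⟨b, hb⟩ := hf'.bound
  exact exists_tendsto_of_abs_deriv_le hf
    (Eventually.of_forall (hasDerivAt_neg_exp_div hκ.ne' b))
    (hb.mono fun t ht => by simpa using ht) (tendsto_neg_exp_div hκ b)

lemma tendsto_zero_of_sq_le_deriv {L L' : ℝ → ℝ} {l : ℝ}
    (hf : ∀ᶠ t in atTop, HasDerivAt f (f' t) t) (hf' : f' =O[atTop] fun _ => (1 : ℝ))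
    (hL : ∀ᶠ t in atTop, HasDerivAt L (L' t) t) (hle : ∀ᶠ t in atTop, f t ^ 2 ≤ L' t)
    (hlim : Tendsto L atTop (𝓝 l)) : Tendsto f atTop (𝓝 0) := by
  obtain ⟨K, hK⟩ := hf'.bound
  obtain ⟨p, hp⟩ : ∃ p, Tendsto (fun t => f t ^ 3) atTop (𝓝 p) := by
    refine exists_tendsto_of_abs_deriv_le (hf.mono fun t ht => ht.fun_pow 3)
      (hL.mono fun t ht => ht.const_mul (3 * |K|)) ?_ (hlim.const_mul (3 * |K|))
    filter_upwards [hle, hK] with t h₁ h₂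
    have h₃ : |f' t| ≤ |K| := (by simpa using h₂ : |f' t| ≤ K).trans (le_abs_self K)
    calc |(3 : ℕ) * f t ^ (3 - 1) * f' t| = |3 * f t ^ 2 * f' t| := by norm_num
      _ = 3 * f t ^ 2 * |f' t| := by rw [abs_mul, abs_of_nonneg (by positivity)]
      _ ≤ 3 * L' t * |K| := by have := (sq_nonneg _).trans h₁; gcongr
      _ = 3 * |K| * L' t := by ring
  set q := |p| ^ (1 / 3 : ℝ)
  have habs : Tendsto (fun t => |f t|) atTop (𝓝 q) := by
    refine (hp.abs.rpow_const (p := 1 / 3) (.inr (by norm_num))).congr fun t => ?_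
    rw [abs_pow, ← Real.rpow_natCast, ← Real.rpow_mul (abs_nonneg _)]
    norm_num
  have hq : q = 0 := by
    by_contra hq
    have hq : 0 < q := (by positivity : 0 ≤ q).lt_of_ne' hq
    refine not_tendsto_nhds_of_tendsto_atTop (tendsto_atTop_of_le_deriv (c := (q / 2) ^ 2)
      (by positivity) hL ?_) l hlim
    filter_upwards [hle, habs.eventually_const_lt (half_lt_self hq)] with t h₁ h₂
    rw [← sq_abs] at h₁
    exact (by gcongr : (q / 2) ^ 2 ≤ |f t| ^ 2).trans h₁
  exact (tendsto_zero_iff_abs_tendsto_zero f).2 (hq ▸ habs)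

/- Subtracting an antiderivative of the error makes `f` monotone. -/
lemma exists_tendsto_of_neg_exp_le_deriv {b B κ : ℝ} (hκ : 0 < κ)
    (hf : ∀ᶠ t in atTop, HasDerivAt f (f' t) t)
    (hf' : ∀ᶠ t in atTop, 0 ≤ f' t + b * Real.exp (-κ * t)) (hB : ∀ᶠ t in atTop, f t ≤ B) :
    ∃ l, Tendsto f atTop (𝓝 l) := by
  have hexp := tendsto_neg_exp_div hκ b
  obtain ⟨l, hl⟩ := exists_tendsto_of_deriv_nonneg (b := B + 1)
    (hf.mono fun t ht => ht.fun_add (hasDerivAt_neg_exp_div hκ.ne' b t)) hf'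
    (by filter_upwards [hB, hexp.eventually_lt_const one_pos] with t h₁ h₂; linarith)
  exact ⟨l - 0, (hl.sub hexp).congr fun t => add_sub_cancel_right _ _⟩

/- `√(u + c² m²)` is differentiable also where `u` vanishes, and it decreases no faster than
`c (1 + 1 / κ) m`. -/
lemma eventually_sqrt_le_of_deriv_ge {u u' m m' : ℝ → ℝ} {c κ : ℝ} (hc : 0 < c) (hκ : 0 < κ)
    (hu : ∀ᶠ t in atTop, HasDerivAt u (u' t) t) (hm : ∀ᶠ t in atTop, HasDerivAt m (m' t) t)
    (hu0 : ∀ᶠ t in atTop, 0 ≤ u t) (hm0 : ∀ᶠ t in atTop, 0 < m t)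
    (hm' : ∀ᶠ t in atTop, m' t ≤ -κ * m t)
    (hu' : ∀ᶠ t in atTop, -(2 * c * m t * √(u t)) ≤ u' t)
    (hu_lim : Tendsto u atTop (𝓝 0)) (hm_lim : Tendsto m atTop (𝓝 0)) :
    ∀ᶠ t in atTop, √(u t) ≤ c * (1 + 1 / κ) * m t := by
  set V : ℝ → ℝ := fun t => √(u t + (c * m t) ^ 2)
  have hpos : ∀ᶠ t in atTop, 0 < u t + (c * m t) ^ 2 := by
    filter_upwards [hu0, hm0] with t h₁ h₂
    positivity
  have hderiv : ∀ᶠ t in atTop, HasDerivAt (fun t => V t - c * (1 + 1 / κ) * m t)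
      ((u' t + 2 * c ^ 2 * m t * m' t) / (2 * V t) - c * (1 + 1 / κ) * m' t) t := by
    filter_upwards [hu, hm, hpos] with t h₁ h₂ h₃
    refine (((h₁.fun_add ((h₂.const_mul c).fun_pow 2)).sqrt h₃.ne').fun_sub
      (h₂.const_mul _)).congr_deriv ?_
    norm_num
    ring
  have hnonneg : ∀ᶠ t in atTop,
      0 ≤ (u' t + 2 * c ^ 2 * m t * m' t) / (2 * V t) - c * (1 + 1 / κ) * m' t := by
    filter_upwards [hu0, hm0, hm', hu', hpos] with t h₁ h₂ h₃ h₄ h₅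
    have hV : 0 < V t := Real.sqrt_pos.2 h₅
    have hmV : c * m t ≤ V t := Real.le_sqrt_of_sq_le (by linarith)
    have huV : √(u t) ≤ V t := Real.sqrt_le_sqrt (by linarith [sq_nonneg (c * m t)])
    have hm'0 : m' t ≤ 0 := h₃.trans (by nlinarith)
    have hforce : -(2 * c * m t * V t) ≤ u' t := le_trans (by gcongr) h₄
    have hdamp : 2 * c * V t * m' t ≤ 2 * c ^ 2 * m t * m' t := by
      nlinarith [mul_nonneg (mul_nonneg hc.le (neg_nonneg.2 hm'0)) (sub_nonneg.2 hmV)]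
    have hκm : m' t / κ ≤ -m t := by rw [div_le_iff₀ hκ]; linarith
    rw [sub_nonneg, le_div_iff₀ (by positivity)]
    calc c * (1 + 1 / κ) * m' t * (2 * V t)
        = 2 * c * V t * m' t + 2 * c * V t * (m' t / κ) := by ring
      _ ≤ 2 * c ^ 2 * m t * m' t + 2 * c * V t * (-m t) := by gcongr
      _ ≤ u' t + 2 * c ^ 2 * m t * m' t := by linarith
  have hlim : Tendsto (fun t => V t - c * (1 + 1 / κ) * m t) atTop (𝓝 0) := by
    simpa using (hu_lim.add ((hm_lim.const_mul c).pow 2)).sqrt.sub (hm_lim.const_mul _)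
  filter_upwards [eventually_monotoneOn_Ici hderiv hnonneg] with T hT
  have hle : V T - c * (1 + 1 / κ) * m T ≤ 0 :=
    ge_of_tendsto hlim ((eventually_ge_atTop T).mono fun t ht => hT Set.self_mem_Ici ht ht)
  have huV : √(u T) ≤ V T := Real.sqrt_le_sqrt (by linarith [sq_nonneg (c * m T)])
  linarith

end Calculus

/-- The evolution, for an irrotational radiation fluid in Bianchi type VII₀, of the quantities
invariant under rotations of the frame about `e₁`: `x = Σ₊`, `R = 𝓡₁`,
`A = Σ₋² + Σ_×² - N₋² - N_×²`, `C = 2 (Σ₋ N₋ + Σ_× N_×)`, `X = Σ_× N₋ - Σ₋ N_×`, `N = N₊` and the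
tilt `v = v₁`. The density parameter is eliminated by the Gauss constraint as `1 - x² - R`. -/
structure InvariantFlow (τ₀ : ℝ) where
  (x R A C X N v : ℝ → ℝ)
  evol_x : ∀ t > τ₀, HasDerivAt x ((x t ^ 2 + A t - 1) * x t - (R t - A t) -
    4 * v t ^ 2 * (1 - x t ^ 2 - R t) / (3 + v t ^ 2)) t
  evol_R : ∀ t > τ₀, HasDerivAt R (2 * (x t ^ 2 + A t + x t) * R t - 2 * (1 + x t) * A t) t
  evol_A : ∀ t > τ₀, HasDerivAt A
    (2 * (x t ^ 2 + A t + x t) * A t - 2 * (1 + x t) * R t - 4 * N t * C t) t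
  evol_C : ∀ t > τ₀, HasDerivAt C (2 * (x t ^ 2 + A t + x t) * C t + 4 * N t * A t) t
  evol_X : ∀ t > τ₀, HasDerivAt X (2 * (x t ^ 2 + A t + x t) * X t) t
  evol_N : ∀ t > τ₀, HasDerivAt N (((1 + x t) ^ 2 + A t) * N t + 3 * C t) t
  evol_v : ∀ t > τ₀, HasDerivAt v (6 * x t * v t * (1 - v t ^ 2) / (3 - v t ^ 2)) t
  v_pos : ∀ t > τ₀, 0 < v t
  v_lt_one : ∀ t > τ₀, v t < 1
  density_pos : ∀ t > τ₀, 0 < 1 - x t ^ 2 - R t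
  X_eq : ∀ t > τ₀, X t = 2 * v t * (1 - x t ^ 2 - R t) / (3 + v t ^ 2)
  R_nonneg : ∀ t > τ₀, 0 ≤ R t
  R_sq : ∀ t > τ₀, R t ^ 2 = A t ^ 2 + C t ^ 2 + 4 * X t ^ 2
  N_pos : ∀ t > τ₀, 0 < N t
  det_pos : ∀ t > τ₀, 0 < N t ^ 2 - 3 / 2 * (R t - A t)

namespace InvariantFlow

variable {τ₀ : ℝ} (F : InvariantFlow τ₀) {t : ℝ}

lemma R_lt_one (ht : t > τ₀) : F.R t < 1 := by
  linarith [F.density_pos t ht, sq_nonneg (F.x t)]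

lemma abs_x_lt_one (ht : t > τ₀) : |F.x t| < 1 := by
  rw [← sq_lt_one_iff_abs_lt_one]
  linarith [F.density_pos t ht, F.R_nonneg t ht]

lemma neg_one_lt_x (ht : t > τ₀) : -1 < F.x t := (abs_lt.1 (F.abs_x_lt_one ht)).1

lemma x_lt_one (ht : t > τ₀) : F.x t < 1 := (abs_lt.1 (F.abs_x_lt_one ht)).2

lemma abs_A_le (ht : t > τ₀) : |F.A t| ≤ F.R t :=
  abs_le_of_sq_le_sq (by nlinarith [F.R_sq t ht, sq_nonneg (F.C t), sq_nonneg (F.X t)])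
    (F.R_nonneg t ht)

lemma abs_C_le (ht : t > τ₀) : |F.C t| ≤ F.R t :=
  abs_le_of_sq_le_sq (by nlinarith [F.R_sq t ht, sq_nonneg (F.A t), sq_nonneg (F.X t)])
    (F.R_nonneg t ht)

lemma two_mul_X_le (ht : t > τ₀) : 2 * F.X t ≤ F.R t :=
  abs_le_of_sq_le_sq' (by nlinarith [F.R_sq t ht, sq_nonneg (F.A t), sq_nonneg (F.C t)])
    (F.R_nonneg t ht) |>.2

lemma A_add_R_nonneg (ht : t > τ₀) : 0 ≤ F.A t + F.R t := by
  linarith [(abs_le.1 (F.abs_A_le ht)).1]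

lemma v_sq_lt_one (ht : t > τ₀) : F.v t ^ 2 < 1 :=
  pow_lt_one₀ (F.v_pos t ht).le (F.v_lt_one t ht) two_ne_zero

lemma X_pos (ht : t > τ₀) : 0 < F.X t := by
  rw [F.X_eq t ht]
  have := F.v_pos t ht
  have := F.density_pos t ht
  positivity

lemma X_le_v (ht : t > τ₀) : F.X t ≤ F.v t := by
  have hv := F.v_pos t ht
  have hΩ : 1 - F.x t ^ 2 - F.R t ≤ 1 := by linarith [F.R_nonneg t ht, sq_nonneg (F.x t)]
  rw [F.X_eq t ht, div_le_iff₀ (by positivity)]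
  calc 2 * F.v t * (1 - F.x t ^ 2 - F.R t) ≤ 2 * F.v t * 1 := by gcongr
    _ ≤ F.v t * (3 + F.v t ^ 2) := by nlinarith [sq_nonneg (F.v t)]

lemma R_pos (ht : t > τ₀) : 0 < F.R t := by
  linarith [F.X_pos ht, F.two_mul_X_le ht]

lemma isBigO_one_of_abs_le {f : ℝ → ℝ} {c : ℝ} (h : ∀ t > τ₀, |f t| ≤ c) :
    f =O[atTop] fun _ => (1 : ℝ) :=
  .of_bound c ((eventually_gt_atTop τ₀).mono fun t ht => by simpa using h t ht)

lemma isBigO_x : F.x =O[atTop] fun _ => (1 : ℝ) :=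
  isBigO_one_of_abs_le fun _ ht => (F.abs_x_lt_one ht).le

lemma isBigO_A : F.A =O[atTop] fun _ => (1 : ℝ) :=
  isBigO_one_of_abs_le fun _ ht => (F.abs_A_le ht).trans (F.R_lt_one ht).le

lemma isBigO_C_R : F.C =O[atTop] F.R :=
  .of_norm_eventuallyLE ((eventually_gt_atTop τ₀).mono fun _ ht => F.abs_C_le ht)

lemma isBigO_C : F.C =O[atTop] fun _ => (1 : ℝ) :=
  isBigO_one_of_abs_le fun _ ht => (F.abs_C_le ht).trans (F.R_lt_one ht).le

/-- The contribution of the tilt to the evolution of `Σ₊`. -/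
noncomputable def tiltStress (t : ℝ) : ℝ :=
  4 * F.v t ^ 2 * (1 - F.x t ^ 2 - F.R t) / (3 + F.v t ^ 2)

lemma tiltStress_nonneg (ht : t > τ₀) : 0 ≤ F.tiltStress t := by
  have := F.density_pos t ht
  unfold tiltStress
  positivity

lemma tiltStress_le (ht : t > τ₀) : F.tiltStress t ≤ 4 := by
  have hv := F.v_sq_lt_one ht
  have hΩ : 1 - F.x t ^ 2 - F.R t ≤ 1 := by linarith [F.R_nonneg t ht, sq_nonneg (F.x t)]
  rw [tiltStress, div_le_iff₀ (by positivity)]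
  calc 4 * F.v t ^ 2 * (1 - F.x t ^ 2 - F.R t) ≤ 4 * 1 * 1 := by
        have := (F.density_pos t ht).le
        gcongr
    _ ≤ 4 * (3 + F.v t ^ 2) := by nlinarith [sq_nonneg (F.v t)]

/-- The derivative of `x`. -/
noncomputable def x' (t : ℝ) : ℝ :=
  (F.x t ^ 2 + F.A t - 1) * F.x t - (F.R t - F.A t) - F.tiltStress t

lemma hasDerivAt_x (ht : t > τ₀) : HasDerivAt F.x (F.x' t) t := F.evol_x t ht

lemma isBigO_x' : F.x' =O[atTop] fun _ => (1 : ℝ) := by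
  have hR : F.R =O[atTop] fun _ => (1 : ℝ) := isBigO_one_of_abs_le fun t ht => by
    rw [abs_of_nonneg (F.R_nonneg t ht)]
    exact (F.R_lt_one ht).le
  have hS : F.tiltStress =O[atTop] fun _ => (1 : ℝ) := isBigO_one_of_abs_le fun t ht => by
    rw [abs_of_nonneg (F.tiltStress_nonneg ht)]
    exact F.tiltStress_le ht
  have hx : (fun t => (F.x t ^ 2 + F.A t - 1) * F.x t) =O[atTop] fun _ => (1 : ℝ) := by
    simpa using (((F.isBigO_x.pow 2).congr_right (by simp)).add F.isBigO_A |>.sub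
      (isBigO_refl _ _)).mul F.isBigO_x
  exact (hx.sub (hR.sub F.isBigO_A)).sub hS

/-- Logarithm of the conserved particle number density in Hubble-normalized form. -/
noncomputable def logPart (t : ℝ) : ℝ :=
  Real.log (F.X t) - Real.log (F.v t) + 1 / 3 * Real.log (1 - F.v t ^ 2)

lemma hasDerivAt_logPart (ht : t > τ₀) :
    HasDerivAt F.logPart (2 * (F.x t ^ 2 + F.A t)) t := by
  have hv := F.v_pos t ht
  have hv₁ : 0 < 1 - F.v t ^ 2 := by linarith [F.v_sq_lt_one ht]
  have hv₃ : 0 < 3 - F.v t ^ 2 := by linarith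
  have hX := F.X_pos ht
  refine ((((F.evol_X t ht).log hX.ne').sub ((F.evol_v t ht).log hv.ne')).add
    (((((F.evol_v t ht).fun_pow 2).const_sub 1).log hv₁.ne').const_mul (1 / 3))).congr_deriv ?_
  simp only [Nat.cast_ofNat, Nat.add_one_sub_one, pow_one]
  field_simp
  ring

lemma log_one_sub_v_sq_nonpos (ht : t > τ₀) : Real.log (1 - F.v t ^ 2) ≤ 0 :=
  Real.log_nonpos (by linarith [F.v_sq_lt_one ht]) (by linarith [sq_nonneg (F.v t)])

lemma logPart_nonpos (ht : t > τ₀) : F.logPart t ≤ 0 := by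
  have := Real.log_le_log (F.X_pos ht) (F.X_le_v ht)
  unfold logPart
  linarith [F.log_one_sub_v_sq_nonpos ht]

/-- Determinant of the non-trivial block of `N_{αβ}`. -/
noncomputable def det (t : ℝ) : ℝ := F.N t ^ 2 - 3 / 2 * (F.R t - F.A t)

lemma hasDerivAt_det (ht : t > τ₀) :
    HasDerivAt F.det (2 * ((1 + F.x t) ^ 2 + F.A t) * F.det t) t := by
  refine (((F.evol_N t ht).fun_pow 2).sub
    (((F.evol_R t ht).sub (F.evol_A t ht)).const_mul (3 / 2))).congr_deriv ?_
  simp only [det, Nat.cast_ofNat, Nat.add_one_sub_one, pow_one]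
  ring

/-- Logarithm of a monotone function of the flow, combining the determinant of `N_{αβ}` and the
particle number density. -/
noncomputable def logMono (t : ℝ) : ℝ :=
  1 / 3 * Real.log (F.det t) + 2 / 3 * F.logPart t - 2 * Real.log (1 + F.x t / 2)

/-- The derivative of `logMono`. -/
noncomputable def logMono' (t : ℝ) : ℝ :=
  (2 / 3 * (1 + 2 * F.x t) ^ 2 + (F.A t + F.R t) + F.tiltStress t) / (1 + F.x t / 2)

lemma hasDerivAt_logMono (ht : t > τ₀) : HasDerivAt F.logMono (F.logMono' t) t := by
  have hD : F.det t ≠ 0 := (F.det_pos t ht).ne'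
  have hx : 1 + F.x t / 2 ≠ 0 := by linarith [F.neg_one_lt_x ht]
  have hx₂ : 2 + F.x t ≠ 0 := by linarith [F.neg_one_lt_x ht]
  refine (((((F.hasDerivAt_det ht).log hD).const_mul (1 / 3)).add
    ((F.hasDerivAt_logPart ht).const_mul (2 / 3))).sub
    (((((F.hasDerivAt_x ht).div_const 2).const_add 1).log hx).const_mul 2)).congr_deriv ?_
  unfold logMono' x'
  field_simp
  ring

lemma le_logMono' (ht : t > τ₀) :
    2 / 3 * (2 / 3 * (1 + 2 * F.x t) ^ 2 + (F.A t + F.R t)) ≤ F.logMono' t := by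
  have hx₁ := F.neg_one_lt_x ht
  have hx₂ := F.x_lt_one ht
  have hS := F.tiltStress_nonneg ht
  have hAR := F.A_add_R_nonneg ht
  have hw : 0 ≤ 2 / 3 * (1 + 2 * F.x t) ^ 2 + (F.A t + F.R t) := by positivity
  rw [logMono', le_div_iff₀ (by linarith)]
  nlinarith

/-- The paper's `M = 1 / N₊`. -/
noncomputable def M (t : ℝ) : ℝ := 1 / F.N t

lemma M_pos (ht : t > τ₀) : 0 < F.M t := one_div_pos.2 (F.N_pos t ht)

lemma N_mul_M (ht : t > τ₀) : F.N t * F.M t = 1 := mul_one_div_cancel (F.N_pos t ht).ne'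

lemma M_le_exp_logMono (ht : t > τ₀) :
    F.M t ≤ Real.exp (3 * Real.log 2) * Real.exp (-(3 / 2 * F.logMono t)) := by
  have hx : -Real.log 2 ≤ Real.log (1 + F.x t / 2) := by
    rw [← Real.log_inv]
    exact Real.log_le_log (by norm_num) (by linarith [F.neg_one_lt_x ht])
  have hdet : Real.log (F.det t) ≤ 2 * Real.log (F.N t) := by
    have hpos : 0 < F.det t := F.det_pos t ht
    have hle : F.det t ≤ F.N t ^ 2 := by
      unfold det
      linarith [(abs_le.1 (F.abs_A_le ht)).2]
    simpa only [Real.log_pow, Nat.cast_ofNat] using Real.log_le_log hpos hle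
  have hmono : F.logMono t = 1 / 3 * Real.log (F.det t) + 2 / 3 * F.logPart t -
    2 * Real.log (1 + F.x t / 2) := rfl
  rw [← Real.exp_add, ← Real.log_le_iff_le_exp (F.M_pos ht), M, one_div, Real.log_inv]
  linarith [F.logPart_nonpos ht]

lemma isBigO_M_one : F.M =O[atTop] fun _ => (1 : ℝ) := by
  obtain ⟨a, ha⟩ := exists_eventually_ge_of_deriv_nonneg
    ((eventually_gt_atTop τ₀).mono fun t ht => F.hasDerivAt_logMono ht)
    ((eventually_gt_atTop τ₀).mono fun t ht => by
      have := F.A_add_R_nonneg ht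
      exact (by positivity : (0 : ℝ) ≤ _).trans (F.le_logMono' ht))
  refine .of_bound (Real.exp (3 * Real.log 2) * Real.exp (-(3 / 2 * a))) ?_
  filter_upwards [ha, eventually_gt_atTop τ₀] with t h ht
  rw [Real.norm_of_nonneg (F.M_pos ht).le, norm_one, mul_one]
  exact (F.M_le_exp_logMono ht).trans (by gcongr)

/-- `C / N₊`, whose derivative is `4 A` to leading order, so that it serves to average `A`. -/
noncomputable def q (t : ℝ) : ℝ := F.C t / F.N t

/-- The part of the derivative of `q` that decays with `1 / N₊`. -/
noncomputable def qError (t : ℝ) : ℝ := F.q t * (F.x t ^ 2 + F.A t - 1 - 3 * F.q t)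

lemma hasDerivAt_q (ht : t > τ₀) : HasDerivAt F.q (4 * F.A t + F.qError t) t := by
  have hN := (F.N_pos t ht).ne'
  refine ((F.evol_C t ht).fun_div (F.evol_N t ht) hN).congr_deriv ?_
  unfold qError q
  field_simp
  ring

lemma q_eq : F.q = fun t => F.C t * F.M t := funext fun _ => div_eq_mul_one_div _ _

lemma isBigO_q : F.q =O[atTop] fun _ => (1 : ℝ) := by
  rw [q_eq]
  simpa using F.isBigO_C.mul F.isBigO_M_one

lemma isBigO_qError : F.qError =O[atTop] fun t => F.C t * F.M t := by
  have hbdd : (fun t => F.x t ^ 2 + F.A t - 1 - 3 * F.q t) =O[atTop] fun _ => (1 : ℝ) :=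
    ((((F.isBigO_x.pow 2).congr_right (by simp)).add F.isBigO_A).sub (isBigO_refl _ _)).sub
      (F.isBigO_q.const_mul_left 3)
  rw [← q_eq]
  exact ((isBigO_refl F.q atTop).mul hbdd).congr (fun _ => rfl) fun _ => mul_one _

/-- `logPart` with the oscillation of its derivative removed. -/
noncomputable def logPartHat (t : ℝ) : ℝ := F.logPart t - F.q t / 2

lemma hasDerivAt_logPartHat (ht : t > τ₀) :
    HasDerivAt F.logPartHat (2 * F.x t ^ 2 - F.qError t / 2) t :=
  ((F.hasDerivAt_logPart ht).fun_sub ((F.hasDerivAt_q ht).div_const 2)).congr_deriv (by ring)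

lemma exists_logPartHat_le : ∃ b, ∀ᶠ t in atTop, F.logPartHat t ≤ b := by
  obtain ⟨k, hk⟩ := F.isBigO_q.bound
  refine ⟨k / 2, ?_⟩
  filter_upwards [hk, eventually_gt_atTop τ₀] with t h ht
  rw [Real.norm_eq_abs, norm_one, mul_one] at h
  unfold logPartHat
  linarith [F.logPart_nonpos ht, neg_abs_le (F.q t)]

lemma C_sq_le (ht : t > τ₀) : F.C t ^ 2 ≤ 2 * (F.A t + F.R t) := by
  have h := abs_le.1 (F.abs_A_le ht)
  nlinarith [F.R_sq t ht, sq_nonneg (F.X t), F.R_lt_one ht]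

/- `x²` and `(1 + 2 x)²` cannot both be small, so that one of the two derivatives is always bounded
below. -/
lemma exists_le_deriv_logPartHat_add_logMono :
    ∃ K > 0, ∀ᶠ t in atTop, 1 / 8 ≤ 2 * F.x t ^ 2 - F.qError t / 2 + K * F.logMono' t := by
  obtain ⟨k, hk⟩ := (F.isBigO_qError.trans
    (by simpa using (isBigO_refl F.C atTop).mul F.isBigO_M_one)).bound
  refine ⟨2 + 2 * k ^ 2, by positivity, ?_⟩
  filter_upwards [hk, eventually_gt_atTop τ₀] with t h ht
  have hAR := F.A_add_R_nonneg ht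
  have hC : k * |F.C t| / 2 ≤ 1 / 8 + k ^ 2 * (F.A t + F.R t) := by
    nlinarith [sq_nonneg (k * |F.C t| - 1 / 2), mul_le_mul_of_nonneg_left (F.C_sq_le ht)
      (sq_nonneg k), sq_abs (F.C t)]
  have hmono : (2 + 2 * k ^ 2) * (2 / 3 * (2 / 3 * (1 + 2 * F.x t) ^ 2 + (F.A t + F.R t))) ≤
      (2 + 2 * k ^ 2) * F.logMono' t := by
    gcongr
    exact F.le_logMono' ht
  have hx : 1 / 4 ≤ 2 * F.x t ^ 2 + (1 + 2 * F.x t) ^ 2 / 2 := by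
    nlinarith [sq_nonneg (1 + 4 * F.x t)]
  have hq : F.qError t ≤ k * |F.C t| := (le_abs_self _).trans (by simpa using h)
  nlinarith [mul_nonneg (sq_nonneg k) (sq_nonneg (1 + 2 * F.x t)), mul_nonneg (sq_nonneg k) hAR,
    sq_nonneg (1 + 2 * F.x t)]

lemma exists_linear_le_logMono : ∃ c > 0, ∃ a, ∀ᶠ t in atTop, c * t + a ≤ F.logMono t := by
  obtain ⟨K, hK, hle⟩ := F.exists_le_deriv_logPartHat_add_logMono
  obtain ⟨b, hb⟩ := F.exists_logPartHat_le
  obtain ⟨a, ha⟩ := exists_linear_le_of_le_deriv ((eventually_gt_atTop τ₀).mono fun t ht =>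
    (F.hasDerivAt_logPartHat ht).fun_add ((F.hasDerivAt_logMono ht).const_mul K)) hle
  refine ⟨1 / 8 / K, by positivity, (a - b) / K, ?_⟩
  filter_upwards [ha, hb] with t h₁ h₂
  rw [div_mul_eq_mul_div, ← add_div, div_le_iff₀ hK]
  linarith

lemma exists_isBigO_M_exp : ∃ κ > 0, F.M =O[atTop] fun t => Real.exp (-κ * t) := by
  obtain ⟨c, hc, a, ha⟩ := F.exists_linear_le_logMono
  refine ⟨3 / 2 * c, by positivity,
    .of_bound (Real.exp (3 * Real.log 2) * Real.exp (-(3 / 2 * a))) ?_⟩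
  filter_upwards [ha, eventually_gt_atTop τ₀] with t h ht
  rw [Real.norm_of_nonneg (F.M_pos ht).le, Real.norm_of_nonneg (Real.exp_pos _).le, mul_assoc,
    ← Real.exp_add]
  exact (F.M_le_exp_logMono ht).trans (by gcongr; linarith)

lemma tendsto_M : Tendsto F.M atTop (𝓝 0) := by
  obtain ⟨κ, hκ, h⟩ := F.exists_isBigO_M_exp
  exact h.trans_tendsto (tendsto_exp_neg_mul hκ)

lemma tendsto_q : Tendsto F.q atTop (𝓝 0) := by
  rw [q_eq]
  exact (F.isBigO_C.mul (isBigO_refl F.M atTop)).trans_tendsto (by simpa using F.tendsto_M)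

lemma exists_tendsto_logPartHat_and_tendsto_x :
    (∃ l, Tendsto F.logPartHat atTop (𝓝 l)) ∧ Tendsto F.x atTop (𝓝 0) := by
  obtain ⟨κ, hκ, hM⟩ := F.exists_isBigO_M_exp
  obtain ⟨b, hb⟩ := (F.isBigO_qError.trans
    (by simpa using F.isBigO_C.mul hM : _ =O[atTop] fun t => Real.exp (-κ * t))).bound
  obtain ⟨B, hB⟩ := F.exists_logPartHat_le
  have hderiv := (eventually_gt_atTop τ₀).mono fun t ht => F.hasDerivAt_logPartHat ht
  have hle : ∀ᶠ t in atTop, F.x t ^ 2 ≤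
      2 * F.x t ^ 2 - F.qError t / 2 + b / 2 * Real.exp (-κ * t) := by
    filter_upwards [hb] with t h
    rw [Real.norm_eq_abs, Real.norm_of_nonneg (Real.exp_pos _).le] at h
    linarith [le_abs_self (F.qError t), sq_nonneg (F.x t)]
  obtain ⟨l, hl⟩ := exists_tendsto_of_neg_exp_le_deriv hκ hderiv
    (hle.mono fun t ht => (sq_nonneg _).trans ht) hB
  exact ⟨⟨l, hl⟩, tendsto_zero_of_sq_le_deriv
    ((eventually_gt_atTop τ₀).mono fun t ht => F.hasDerivAt_x ht) F.isBigO_x'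
    (hderiv.mono fun t ht => ht.fun_add (hasDerivAt_neg_exp_div hκ.ne' (b / 2) t)) hle
    (hl.add (tendsto_neg_exp_div hκ _))⟩

lemma tendsto_x : Tendsto F.x atTop (𝓝 0) := F.exists_tendsto_logPartHat_and_tendsto_x.2

lemma exists_tendsto_logPart : ∃ l, Tendsto F.logPart atTop (𝓝 l) := by
  obtain ⟨l, hl⟩ := F.exists_tendsto_logPartHat_and_tendsto_x.1
  exact ⟨_, (hl.add (F.tendsto_q.div_const 2)).congr fun t => sub_add_cancel _ _⟩

/-- A function comparable to half the logarithm of the tilt, with the oscillation of its derivative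
removed. -/
noncomputable def logTilt (t : ℝ) : ℝ :=
  F.x t + (1 / 2 * Real.log (F.v t) - 1 / 6 * Real.log (1 - F.v t ^ 2)) - F.logPart t / 2 -
    F.x t * F.q t / 4

/-- The derivative of `logTilt`. -/
noncomputable def logTilt' (t : ℝ) : ℝ :=
  F.x t ^ 3 - F.x t ^ 2 - F.R t - F.tiltStress t - (F.x' t * F.q t + F.x t * F.qError t) / 4

lemma hasDerivAt_logTilt (ht : t > τ₀) : HasDerivAt F.logTilt (F.logTilt' t) t := by
  have hv := F.v_pos t ht
  have hv₁ : 0 < 1 - F.v t ^ 2 := by linarith [F.v_sq_lt_one ht]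
  have hv₃ : 0 < 3 - F.v t ^ 2 := by linarith
  have hv' : HasDerivAt
      (fun t => 1 / 2 * Real.log (F.v t) - 1 / 6 * Real.log (1 - F.v t ^ 2)) (F.x t) t := by
    refine ((((F.evol_v t ht).log hv.ne').const_mul (1 / 2)).fun_sub
      (((((F.evol_v t ht).fun_pow 2).const_sub 1).log hv₁.ne').const_mul (1 / 6))).congr_deriv ?_
    simp only [Nat.cast_ofNat, Nat.add_one_sub_one, pow_one]
    field_simp
    ring
  refine ((((F.hasDerivAt_x ht).fun_add hv').fun_sub
    ((F.hasDerivAt_logPart ht).div_const 2)).fun_sub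
    (((F.hasDerivAt_x ht).fun_mul (F.hasDerivAt_q ht)).div_const 4)).congr_deriv ?_
  unfold logTilt' x'
  ring

lemma isLittleO_C_mul_M : (fun t => F.C t * F.M t) =o[atTop] F.R := by
  simpa using F.isBigO_C_R.mul_isLittleO ((isLittleO_one_iff ℝ).2 F.tendsto_M)

lemma eventually_logTilt'_le : ∀ᶠ t in atTop, F.logTilt' t ≤ -(F.R t / 2) := by
  have hq : (fun t => F.x' t * F.q t + F.x t * F.qError t) =o[atTop] F.R := by
    have h₁ := F.isBigO_x'.mul_isLittleO F.isLittleO_C_mul_M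
    have h₂ := F.isBigO_x.mul_isLittleO (F.isBigO_qError.trans_isLittleO F.isLittleO_C_mul_M)
    simpa only [one_mul, q_eq] using h₁.add h₂
  filter_upwards [hq.bound two_pos, eventually_gt_atTop τ₀] with t h ht
  rw [Real.norm_eq_abs, Real.norm_of_nonneg (F.R_nonneg t ht)] at h
  unfold logTilt'
  nlinarith [neg_abs_le (F.x' t * F.q t + F.x t * F.qError t), F.tiltStress_nonneg ht,
    mul_nonneg (sq_nonneg (F.x t)) (sub_nonneg.2 (F.x_lt_one ht).le)]

lemma logPart_le_log_one_sub_v_sq (ht : t > τ₀) :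
    F.logPart t ≤ 1 / 3 * Real.log (1 - F.v t ^ 2) := by
  unfold logPart
  linarith [Real.log_le_log (F.X_pos ht) (F.X_le_v ht)]

lemma exists_mul_v_le_X : ∃ c > 0, ∀ᶠ t in atTop, c * F.v t ≤ F.X t := by
  obtain ⟨l, hl⟩ := F.exists_tendsto_logPart
  refine ⟨Real.exp (l - 1), Real.exp_pos _, ?_⟩
  filter_upwards [hl.eventually_const_le (sub_one_lt l), eventually_gt_atTop τ₀] with t h ht
  have hv := F.v_pos t ht
  have hlog : l - 1 + Real.log (F.v t) ≤ Real.log (F.X t) := by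
    unfold logPart at h
    linarith [F.log_one_sub_v_sq_nonpos ht]
  calc Real.exp (l - 1) * F.v t = Real.exp (l - 1 + Real.log (F.v t)) := by
        rw [Real.exp_add, Real.exp_log hv]
    _ ≤ Real.exp (Real.log (F.X t)) := Real.exp_le_exp.2 hlog
    _ = F.X t := Real.exp_log (F.X_pos ht)

lemma isBigO_two_mul_logTilt_sub_log_v :
    (fun t => 2 * F.logTilt t - Real.log (F.v t)) =O[atTop] fun _ => (1 : ℝ) := by
  obtain ⟨l, hl⟩ := F.exists_tendsto_logPart
  have hv : (fun t => 1 / 3 * Real.log (1 - F.v t ^ 2)) =O[atTop] fun _ => (1 : ℝ) := by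
    refine .trans (.of_bound' ?_) (hl.isBigO_one ℝ)
    filter_upwards [eventually_gt_atTop τ₀] with t ht
    have := F.log_one_sub_v_sq_nonpos ht
    have hle := F.logPart_le_log_one_sub_v_sq ht
    rw [Real.norm_eq_abs, Real.norm_eq_abs, abs_of_nonpos (by linarith),
      abs_of_nonpos (by linarith)]
    linarith
  have hxq : (fun t => F.x t * F.q t) =O[atTop] fun _ => (1 : ℝ) := by
    simpa using F.isBigO_x.mul F.isBigO_q
  refine ((((F.isBigO_x.const_mul_left 2).sub hv).sub (hl.isBigO_one ℝ)).sub
    (hxq.const_mul_left (1 / 2))).congr_left fun t => ?_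
  unfold logTilt
  ring

/- The velocity is comparable to `exp (2 logTilt)`, which obeys `y' ≤ -R y ≤ -2 X y ≤ -c y²`. -/
lemma tendsto_v : Tendsto F.v atTop (𝓝 0) := by
  obtain ⟨k, hk⟩ := F.isBigO_two_mul_logTilt_sub_log_v.bound
  obtain ⟨c, hc, hX⟩ := F.exists_mul_v_le_X
  have hk : ∀ᶠ t in atTop, Real.exp (2 * F.logTilt t - k) ≤ F.v t ∧
      F.v t ≤ Real.exp (k + 2 * F.logTilt t) := by
    filter_upwards [hk, eventually_gt_atTop τ₀] with t h ht
    rw [Real.norm_eq_abs, norm_one, mul_one, abs_le] at h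
    rw [← Real.le_log_iff_exp_le (F.v_pos t ht), ← Real.log_le_iff_le_exp (F.v_pos t ht)]
    constructor <;> linarith
  have hlim : Tendsto (fun t => Real.exp (-(2 * F.logTilt t))) atTop atTop := by
    refine tendsto_atTop_of_le_deriv (c := 2 * c * Real.exp (-k)) (by positivity)
      ((eventually_gt_atTop τ₀).mono fun t ht =>
        ((F.hasDerivAt_logTilt ht).const_mul 2).fun_neg.exp) ?_
    filter_upwards [F.eventually_logTilt'_le, hX, hk, eventually_gt_atTop τ₀] with t h₁ h₂ h₃ ht
    calc 2 * c * Real.exp (-k)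
        = Real.exp (-(2 * F.logTilt t)) * (2 * (c * Real.exp (2 * F.logTilt t - k))) := by
          rw [sub_eq_add_neg (2 * F.logTilt t), Real.exp_add, Real.exp_neg (2 * F.logTilt t)]
          field_simp
      _ ≤ Real.exp (-(2 * F.logTilt t)) * (2 * (c * F.v t)) := by gcongr; exact h₃.1
      _ ≤ Real.exp (-(2 * F.logTilt t)) * F.R t := by
          gcongr
          linarith [F.two_mul_X_le ht]
      _ ≤ Real.exp (-(2 * F.logTilt t)) * -(2 * F.logTilt' t) := by gcongr; linarith
  have hexp : Tendsto (fun t => Real.exp (k + 2 * F.logTilt t)) atTop (𝓝 0) := by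
    simpa only [Pi.inv_apply, ← Real.exp_neg, neg_neg, ← Real.exp_add, mul_zero]
      using hlim.inv_tendsto_atTop.const_mul (Real.exp k)
  exact squeeze_zero' ((eventually_gt_atTop τ₀).mono fun t ht => (F.v_pos t ht).le)
    (hk.mono fun t ht => ht.2) hexp

lemma tendsto_X : Tendsto F.X atTop (𝓝 0) :=
  squeeze_zero' ((eventually_gt_atTop τ₀).mono fun _ ht => (F.X_pos ht).le)
    ((eventually_gt_atTop τ₀).mono fun _ ht => F.X_le_v ht) F.tendsto_v

/-- `R / X`. The point `(r, a, c)` moves on the hyperboloid `r² = a² + c² + 4`. -/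
noncomputable def r (t : ℝ) : ℝ := F.R t / F.X t

/-- `A / X`. -/
noncomputable def a (t : ℝ) : ℝ := F.A t / F.X t

/-- `C / X`. -/
noncomputable def c (t : ℝ) : ℝ := F.C t / F.X t

lemma hasDerivAt_r (ht : t > τ₀) : HasDerivAt F.r (-2 * (1 + F.x t) * F.a t) t := by
  have hX := (F.X_pos ht).ne'
  refine ((F.evol_R t ht).fun_div (F.evol_X t ht) hX).congr_deriv ?_
  unfold a
  field_simp
  ring

lemma hasDerivAt_a (ht : t > τ₀) :
    HasDerivAt F.a (-2 * (1 + F.x t) * F.r t - 4 * F.N t * F.c t) t := by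
  have hX := (F.X_pos ht).ne'
  refine ((F.evol_A t ht).fun_div (F.evol_X t ht) hX).congr_deriv ?_
  unfold r c
  field_simp
  ring

lemma hasDerivAt_c (ht : t > τ₀) : HasDerivAt F.c (4 * F.N t * F.a t) t := by
  have hX := (F.X_pos ht).ne'
  refine ((F.evol_C t ht).fun_div (F.evol_X t ht) hX).congr_deriv ?_
  unfold a
  field_simp
  ring

lemma two_le_r (ht : t > τ₀) : 2 ≤ F.r t := by
  rw [r, le_div_iff₀ (F.X_pos ht)]
  exact F.two_mul_X_le ht

lemma r_sq (ht : t > τ₀) : F.r t ^ 2 = F.a t ^ 2 + F.c t ^ 2 + 4 := by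
  have hX := (F.X_pos ht).ne'
  unfold r a c
  field_simp
  linarith [F.R_sq t ht]

lemma isBigO_c_r : F.c =O[atTop] F.r := by
  refine .of_norm_eventuallyLE ((eventually_gt_atTop τ₀).mono fun t ht => ?_)
  exact (Real.norm_eq_abs _).trans_le (abs_le_of_sq_le_sq
    (by nlinarith [F.r_sq ht, sq_nonneg (F.a t)]) (by linarith [F.two_le_r ht]))

/-- The logarithmic decay rate of `M`. -/
noncomputable def rate (t : ℝ) : ℝ := (1 + F.x t) ^ 2 + F.A t + 3 * F.q t

lemma hasDerivAt_M (ht : t > τ₀) : HasDerivAt F.M (-F.rate t * F.M t) t := by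
  have hN := (F.N_pos t ht).ne'
  have hM : F.M = fun s => (F.N s)⁻¹ := funext fun _ => one_div _
  rw [hM]
  refine ((F.evol_N t ht).fun_inv hN).congr_deriv ?_
  unfold rate q
  field_simp

lemma isBigO_rate : F.rate =O[atTop] fun _ => (1 : ℝ) :=
  (((((isBigO_refl _ _).add F.isBigO_x).pow 2).congr_right (by simp)).add F.isBigO_A).add
    (F.isBigO_q.const_mul_left 3)

/-- `r` with the oscillation of its derivative removed. -/
noncomputable def rHat (t : ℝ) : ℝ := F.r t + (1 + F.x t) * F.c t * F.M t / 2

/-- The derivative of `rHat`. -/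
noncomputable def rHat' (t : ℝ) : ℝ := F.c t * F.M t * ((F.x' t - (1 + F.x t) * F.rate t) / 2)

lemma hasDerivAt_rHat (ht : t > τ₀) : HasDerivAt F.rHat (F.rHat' t) t := by
  refine ((F.hasDerivAt_r ht).fun_add (((((F.hasDerivAt_x ht).const_add 1).fun_mul
    (F.hasDerivAt_c ht)).fun_mul (F.hasDerivAt_M ht)).div_const 2)).congr_deriv ?_
  unfold rHat'
  linear_combination 2 * (1 + F.x t) * F.a t * F.N_mul_M ht

lemma isBigO_rHat' : F.rHat' =O[atTop] fun t => F.r t * F.M t := by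
  have hbdd : (fun t => (F.x' t - (1 + F.x t) * F.rate t) / 2) =O[atTop] fun _ => (1 : ℝ) := by
    have h₁ := F.isBigO_x'.sub
      ((((isBigO_refl _ _).add F.isBigO_x).mul F.isBigO_rate).congr_right (by simp))
    exact (h₁.const_mul_left (1 / 2)).congr_left fun t => by ring
  exact ((F.isBigO_c_r.mul (isBigO_refl F.M atTop)).mul hbdd).congr_right fun t => mul_one _

lemma tendsto_rHat_div_r : Tendsto (fun t => F.rHat t / F.r t) atTop (𝓝 1) := by
  have h : Tendsto (fun t => (1 + F.x t) / 2 * (F.c t * F.M t / F.r t)) atTop (𝓝 0) := by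
    have hcM : (fun t => F.c t * F.M t) =o[atTop] F.r := by
      simpa using F.isBigO_c_r.mul_isLittleO ((isLittleO_one_iff ℝ).2 F.tendsto_M)
    simpa using ((F.tendsto_x.const_add 1).div_const 2).mul hcM.tendsto_div_nhds_zero
  rw [show (1 : ℝ) = 1 + 0 from (add_zero 1).symm]
  refine (h.const_add 1).congr' ?_
  filter_upwards [eventually_gt_atTop τ₀] with t ht
  have hr : F.r t ≠ 0 := by linarith [F.two_le_r ht]
  unfold rHat
  field_simp

/- The logarithm of `rHat` has an exponentially decaying derivative. -/
lemma exists_tendsto_r : ∃ l, Tendsto F.r atTop (𝓝 l) := by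
  obtain ⟨κ, hκ, hM⟩ := F.exists_isBigO_M_exp
  have hhat : ∀ᶠ t in atTop, F.r t ≤ 2 * F.rHat t ∧ 0 < F.rHat t := by
    filter_upwards [F.tendsto_rHat_div_r.eventually_const_le one_half_lt_one,
      eventually_gt_atTop τ₀] with t h ht
    have hr := F.two_le_r ht
    rw [le_div_iff₀ (by linarith)] at h
    constructor <;> linarith
  have hlog' : (fun t => F.rHat' t / F.rHat t) =O[atTop] fun t => Real.exp (-κ * t) := by
    have hr : (fun t => F.r t / F.rHat t) =O[atTop] fun _ => (1 : ℝ) := by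
      refine .of_bound 2 ?_
      filter_upwards [hhat, eventually_gt_atTop τ₀] with t h ht
      rw [Real.norm_of_nonneg (div_nonneg (by linarith [F.two_le_r ht]) h.2.le), norm_one,
        mul_one, div_le_iff₀ h.2]
      exact h.1
    calc (fun t => F.rHat' t / F.rHat t)
        = fun t => F.rHat' t * (F.rHat t)⁻¹ := funext fun _ => div_eq_mul_inv _ _
      _ =O[atTop] fun t => F.r t * F.M t * (F.rHat t)⁻¹ := F.isBigO_rHat'.mul (isBigO_refl _ _)
      _ = fun t => F.M t * (F.r t / F.rHat t) := funext fun _ => by ring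
      _ =O[atTop] fun t => Real.exp (-κ * t) := by simpa using hM.mul hr
  obtain ⟨l, hl⟩ := exists_tendsto_of_deriv_isBigO_exp hκ
    (((eventually_gt_atTop τ₀).and hhat).mono fun t ht =>
      (F.hasDerivAt_rHat ht.1).log ht.2.2.ne') hlog'
  have hrHat : Tendsto F.rHat atTop (𝓝 (Real.exp l)) :=
    (Real.continuous_exp.tendsto l |>.comp hl).congr' (hhat.mono fun t ht => Real.exp_log ht.2)
  refine ⟨_, (hrHat.div F.tendsto_rHat_div_r one_ne_zero).congr' ?_⟩
  filter_upwards [hhat] with t h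
  exact div_div_cancel₀ h.2.ne'

lemma tendsto_R : Tendsto F.R atTop (𝓝 0) := by
  obtain ⟨l, hl⟩ := F.exists_tendsto_r
  have h : Tendsto (fun t => F.r t * F.X t) atTop (𝓝 0) := by simpa using hl.mul F.tendsto_X
  exact h.congr' ((eventually_gt_atTop τ₀).mono fun t ht => div_mul_cancel₀ _ (F.X_pos ht).ne')

lemma tendsto_A : Tendsto F.A atTop (𝓝 0) :=
  squeeze_zero_norm' ((eventually_gt_atTop τ₀).mono fun _ ht => F.abs_A_le ht) F.tendsto_R

lemma tendsto_rate : Tendsto F.rate atTop (𝓝 1) := by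
  simpa using show Tendsto F.rate atTop (𝓝 _) from
    (((F.tendsto_x.const_add 1).pow 2).add F.tendsto_A).add (F.tendsto_q.const_mul 3)

lemma tendsto_X_mul_N : Tendsto (fun t => F.X t * F.N t) atTop atTop := by
  have hlim : Tendsto (fun t => 2 * (F.x t ^ 2 + F.A t + F.x t) + F.rate t) atTop (𝓝 1) := by
    simpa using ((((F.tendsto_x.pow 2).add F.tendsto_A).add F.tendsto_x).const_mul 2).add
      F.tendsto_rate
  have hlog : Tendsto (fun t => Real.log (F.X t * F.N t)) atTop atTop := by
    refine tendsto_atTop_of_le_deriv one_half_pos ?_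
      (hlim.eventually_const_le one_half_lt_one)
    filter_upwards [eventually_gt_atTop τ₀] with t ht
    have hX := (F.X_pos ht).ne'
    have hN := (F.N_pos t ht).ne'
    refine (((F.evol_X t ht).fun_mul (F.evol_N t ht)).log (mul_ne_zero hX hN)).congr_deriv ?_
    unfold rate q
    field_simp
  refine (Real.tendsto_exp_atTop.comp hlog).congr' ?_
  filter_upwards [eventually_gt_atTop τ₀] with t ht
  exact Real.exp_log (mul_pos (F.X_pos ht) (F.N_pos t ht))

/-- The paper's `𝓡₂`. -/
noncomputable def amplitude (t : ℝ) : ℝ := √(F.A t ^ 2 + F.C t ^ 2)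

lemma amplitude_div_R (ht : t > τ₀) : F.amplitude t / F.R t = √(1 - 4 / F.r t ^ 2) := by
  have hR := F.R_pos ht
  have hX := (F.X_pos ht).ne'
  nth_rw 1 [← Real.sqrt_sq hR.le]
  rw [amplitude, ← Real.sqrt_div' _ (sq_nonneg _), r]
  congr 1
  field_simp
  linarith [F.R_sq t ht]

lemma exists_tendsto_amplitude_div_R :
    ∃ k, Tendsto (fun t => F.amplitude t / F.R t) atTop (𝓝 k) := by
  obtain ⟨l, hl⟩ := F.exists_tendsto_r
  have hl2 : 2 ≤ l := ge_of_tendsto hl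
    ((eventually_gt_atTop τ₀).mono fun t ht => F.two_le_r ht)
  exact ⟨_, (((tendsto_const_nhds (x := (4 : ℝ))).div (hl.pow 2) (by positivity)).const_sub
    1).sqrt.congr' ((eventually_gt_atTop τ₀).mono fun t ht => (F.amplitude_div_R ht).symm)⟩

lemma exists_mul_R_le_amplitude
    (h : ¬ Tendsto (fun t => F.amplitude t / F.R t) atTop (𝓝 0)) :
    ∃ δ > 0, ∀ᶠ t in atTop, δ * F.R t ≤ F.amplitude t := by
  obtain ⟨k, hk⟩ := F.exists_tendsto_amplitude_div_R
  have hk0 : 0 ≤ k := ge_of_tendsto hk ((eventually_gt_atTop τ₀).mono fun t ht =>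
    div_nonneg (Real.sqrt_nonneg _) (F.R_nonneg t ht))
  have hkpos : 0 < k := hk0.lt_of_ne' fun hk' => h (hk' ▸ hk)
  refine ⟨k / 2, half_pos hkpos, ?_⟩
  filter_upwards [hk.eventually_const_le (half_lt_self hkpos), eventually_gt_atTop τ₀] with t h ht
  rwa [le_div_iff₀ (F.R_pos ht)] at h

lemma tendsto_r_of_tendsto_amplitude_div_R
    (h : Tendsto (fun t => F.amplitude t / F.R t) atTop (𝓝 0)) : Tendsto F.r atTop (𝓝 2) := by
  obtain ⟨l, hl⟩ := F.exists_tendsto_r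
  have hl2 : 2 ≤ l := ge_of_tendsto hl
    ((eventually_gt_atTop τ₀).mono fun t ht => F.two_le_r ht)
  have hlim : Tendsto (fun t => F.r t ^ 2 * (1 - (F.amplitude t / F.R t) ^ 2)) atTop
      (𝓝 (l ^ 2)) := by
    simpa using (hl.pow 2).mul ((h.pow 2).const_sub 1)
  have hl4 : l ^ 2 = 4 := by
    refine tendsto_nhds_unique (hlim.congr' ?_) tendsto_const_nhds
    filter_upwards [eventually_gt_atTop τ₀] with t ht
    have hr := F.two_le_r ht
    rw [F.amplitude_div_R ht, Real.sq_sqrt]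
    · field_simp
      ring
    · rw [sub_nonneg, div_le_one (by positivity)]
      nlinarith
  rwa [show l = 2 by nlinarith] at hl

/-- The part `3 Ω (1 - v²) / (3 + v²)` of the density that drives `1 + Σ₊`. -/
noncomputable def E (t : ℝ) : ℝ := 3 / 2 * (F.X t / F.v t * (1 - F.v t ^ 2))

lemma E_eq (ht : t > τ₀) :
    F.E t = 3 * (1 - F.x t ^ 2 - F.R t) * (1 - F.v t ^ 2) / (3 + F.v t ^ 2) := by
  have hv := (F.v_pos t ht).ne'
  have hv₃ : 3 + F.v t ^ 2 ≠ 0 := by positivity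
  rw [E, F.X_eq t ht]
  field_simp

lemma x'_eq (ht : t > τ₀) : F.x' t = F.E t - (1 - F.x t ^ 2 - F.A t) * (1 + F.x t) := by
  have hv₃ : 3 + F.v t ^ 2 ≠ 0 := by positivity
  rw [F.E_eq ht, x', tiltStress]
  field_simp
  ring

lemma tendsto_E : Tendsto F.E atTop (𝓝 1) := by
  have hv := F.tendsto_v.pow 2
  have h : Tendsto (fun t => 3 * (1 - F.x t ^ 2 - F.R t) * (1 - F.v t ^ 2) / (3 + F.v t ^ 2))
      atTop (𝓝 1) := by
    have h := ((((F.tendsto_x.pow 2).const_sub 1).sub F.tendsto_R).const_mul 3).mul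
      (hv.const_sub 1) |>.div (hv.const_add 3) (by norm_num)
    norm_num at h
    exact h
  exact h.congr' ((eventually_gt_atTop τ₀).mono fun t ht => (F.E_eq ht).symm)

lemma tendsto_x' : Tendsto F.x' atTop (𝓝 0) := by
  have h : Tendsto (fun t => F.E t - (1 - F.x t ^ 2 - F.A t) * (1 + F.x t)) atTop (𝓝 0) := by
    simpa using F.tendsto_E.sub ((((F.tendsto_x.pow 2).const_sub 1).sub F.tendsto_A).mul
      (F.tendsto_x.const_add 1))
  exact h.congr' ((eventually_gt_atTop τ₀).mono fun t ht => (F.x'_eq ht).symm)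

/-- The derivative of `E`. -/
noncomputable def E' (t : ℝ) : ℝ := F.E t *
  (2 * (F.x t ^ 2 + F.A t + F.x t) - 6 * F.x t * (1 + F.v t ^ 2) / (3 - F.v t ^ 2))

lemma hasDerivAt_E (ht : t > τ₀) : HasDerivAt F.E (F.E' t) t := by
  have hv := (F.v_pos t ht).ne'
  have hv₃ : 3 - F.v t ^ 2 ≠ 0 := by linarith [F.v_sq_lt_one ht]
  refine ((((F.evol_X t ht).fun_div (F.evol_v t ht) hv).fun_mul
    (((F.evol_v t ht).fun_pow 2).const_sub 1)).const_mul (3 / 2)).congr_deriv ?_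
  simp only [Nat.cast_ofNat, Nat.add_one_sub_one, pow_one, E', E]
  field_simp
  ring

lemma tendsto_E' : Tendsto F.E' atTop (𝓝 0) := by
  have hv := F.tendsto_v.pow 2
  simpa using show Tendsto F.E' atTop (𝓝 _) from F.tendsto_E.mul
    (((((F.tendsto_x.pow 2).add F.tendsto_A).add F.tendsto_x).const_mul 2).sub
      (((F.tendsto_x.const_mul 6).mul (hv.const_add 1)).div (hv.const_sub 3) (by norm_num)))

/-- `C / X` with its first-order drift removed. -/
noncomputable def cTilde (t : ℝ) : ℝ := F.c t + (1 + F.x t) * F.r t * F.M t / 2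

/-- The forcing term of `cTilde`, multiplied by `2 N`. -/
noncomputable def G (t : ℝ) : ℝ :=
  F.r t * (F.E t - 2 * (1 + F.x t) ^ 2 - 3 * (1 + F.x t) * F.q t) - 2 * (1 + F.x t) ^ 2 * F.a t

/-- `A / X` with its second-order drift removed. -/
noncomputable def aTilde (t : ℝ) : ℝ := F.a t + F.G t * F.M t ^ 2 / 8

lemma hasDerivAt_a_eq_cTilde (ht : t > τ₀) :
    HasDerivAt F.a (-4 * F.N t * F.cTilde t) t := by
  refine (F.hasDerivAt_a ht).congr_deriv ?_
  unfold cTilde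
  linear_combination 2 * (1 + F.x t) * F.r t * F.N_mul_M ht

lemma hasDerivAt_cTilde (ht : t > τ₀) : HasDerivAt F.cTilde (4 * F.N t * F.aTilde t) t := by
  refine ((F.hasDerivAt_c ht).fun_add (((((F.hasDerivAt_x ht).const_add 1).fun_mul
    (F.hasDerivAt_r ht)).fun_mul (F.hasDerivAt_M ht)).div_const 2)).congr_deriv ?_
  rw [F.x'_eq ht, aTilde, rate, G]
  linear_combination (-F.M t * (F.r t * (F.E t - 2 * (1 + F.x t) ^ 2 - 3 * (1 + F.x t) * F.q t) -
    2 * (1 + F.x t) ^ 2 * F.a t) / 2) * F.N_mul_M ht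

/-- The derivative of `G`, up to the term with a factor `N`. -/
noncomputable def G' (t : ℝ) : ℝ :=
  -2 * (1 + F.x t) * F.a t * (F.E t - 2 * (1 + F.x t) ^ 2 - 3 * (1 + F.x t) * F.q t) +
    F.r t * (F.E' t - 4 * (1 + F.x t) * F.x' t -
      (3 * F.x' t * F.q t + 3 * (1 + F.x t) * (4 * F.A t + F.qError t))) -
    4 * (1 + F.x t) * F.x' t * F.a t

lemma hasDerivAt_G (ht : t > τ₀) :
    HasDerivAt F.G (F.G' t + 8 * (1 + F.x t) ^ 2 * F.N t * F.cTilde t) t := by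
  have hx := (F.hasDerivAt_x ht).const_add 1
  refine (((F.hasDerivAt_r ht).fun_mul (((F.hasDerivAt_E ht).fun_sub
    ((hx.fun_pow 2).const_mul 2)).fun_sub ((hx.const_mul 3).fun_mul
    (F.hasDerivAt_q ht)))).fun_sub
    (((hx.fun_pow 2).const_mul 2).fun_mul (F.hasDerivAt_a_eq_cTilde ht))).congr_deriv ?_
  simp only [Nat.cast_ofNat, Nat.add_one_sub_one, pow_one, G']
  ring

/-- The forcing term of `aTilde`, multiplied by `N`. -/
noncomputable def Q (t : ℝ) : ℝ :=
  (F.G' t * F.M t + 8 * (1 + F.x t) ^ 2 * F.cTilde t - 2 * F.G t * F.M t * F.rate t) / 8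

lemma hasDerivAt_aTilde (ht : t > τ₀) :
    HasDerivAt F.aTilde (-4 * F.N t * F.cTilde t + F.Q t * F.M t) t := by
  refine ((F.hasDerivAt_a_eq_cTilde ht).fun_add (((F.hasDerivAt_G ht).fun_mul
    ((F.hasDerivAt_M ht).fun_pow 2)).div_const 8)).congr_deriv ?_
  simp only [Nat.cast_ofNat, Nat.add_one_sub_one, pow_one, Q]
  linear_combination (1 + F.x t) ^ 2 * F.cTilde t * F.M t * F.N_mul_M ht

section RTendstoTwo

variable {F} (hr : Tendsto F.r atTop (𝓝 2))
include hr

lemma tendsto_sqrt_r_sq_sub_four : Tendsto (fun t => √(F.r t ^ 2 - 4)) atTop (𝓝 0) := by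
  convert ((hr.pow 2).sub_const 4).sqrt
  norm_num

lemma tendsto_a_of_tendsto_r : Tendsto F.a atTop (𝓝 0) := by
  refine squeeze_zero_norm' ((eventually_gt_atTop τ₀).mono fun t ht => ?_)
    (tendsto_sqrt_r_sq_sub_four hr)
  exact Real.abs_le_sqrt (by linarith [F.r_sq ht, sq_nonneg (F.c t)])

lemma tendsto_c_of_tendsto_r : Tendsto F.c atTop (𝓝 0) := by
  refine squeeze_zero_norm' ((eventually_gt_atTop τ₀).mono fun t ht => ?_)
    (tendsto_sqrt_r_sq_sub_four hr)
  exact Real.abs_le_sqrt (by linarith [F.r_sq ht, sq_nonneg (F.a t)])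

lemma tendsto_cTilde_of_tendsto_r : Tendsto F.cTilde atTop (𝓝 0) := by
  simpa using show Tendsto F.cTilde atTop (𝓝 _) from (tendsto_c_of_tendsto_r hr).add
    ((((F.tendsto_x.const_add 1).mul hr).mul F.tendsto_M).div_const 2)

lemma tendsto_G_of_tendsto_r : Tendsto F.G atTop (𝓝 (-2)) := by
  have hx := F.tendsto_x.const_add 1
  have h : Tendsto F.G atTop (𝓝 _) := (hr.mul ((F.tendsto_E.sub ((hx.pow 2).const_mul 2)).sub
    ((hx.const_mul 3).mul F.tendsto_q))).sub
    (((hx.pow 2).const_mul 2).mul (tendsto_a_of_tendsto_r hr))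
  norm_num at h
  exact h

lemma tendsto_aTilde_of_tendsto_r : Tendsto F.aTilde atTop (𝓝 0) := by
  simpa using show Tendsto F.aTilde atTop (𝓝 _) from (tendsto_a_of_tendsto_r hr).add
    (((tendsto_G_of_tendsto_r hr).mul (F.tendsto_M.pow 2)).div_const 8)

lemma tendsto_G'_of_tendsto_r : Tendsto F.G' atTop (𝓝 0) := by
  have hx := F.tendsto_x.const_add 1
  have ha := tendsto_a_of_tendsto_r hr
  have hqError : Tendsto F.qError atTop (𝓝 0) :=
    F.isBigO_qError.trans_tendsto (by simpa only [← q_eq] using F.tendsto_q)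
  simpa using show Tendsto F.G' atTop (𝓝 _) from
    (((((hx.const_mul (-2)).mul ha).mul ((F.tendsto_E.sub ((hx.pow 2).const_mul 2)).sub
      ((hx.const_mul 3).mul F.tendsto_q))).add
    (hr.mul ((F.tendsto_E'.sub ((hx.const_mul 4).mul F.tendsto_x')).sub
      (((F.tendsto_x'.const_mul 3).mul F.tendsto_q).add
        ((hx.const_mul 3).mul ((F.tendsto_A.const_mul 4).add hqError)))))).sub
    (((hx.const_mul 4).mul F.tendsto_x').mul ha))

lemma tendsto_Q_of_tendsto_r : Tendsto F.Q atTop (𝓝 0) := by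
  have hx := F.tendsto_x.const_add 1
  simpa using show Tendsto F.Q atTop (𝓝 _) from
    ((((tendsto_G'_of_tendsto_r hr).mul F.tendsto_M).add
      (((hx.pow 2).const_mul 8).mul (tendsto_cTilde_of_tendsto_r hr))).sub
      ((((tendsto_G_of_tendsto_r hr).const_mul 2).mul F.tendsto_M).mul F.tendsto_rate)).div_const 8

lemma eventually_abs_cTilde_le : ∀ᶠ t in atTop, |F.cTilde t| ≤ F.M t / 4 := by
  have h := eventually_sqrt_le_of_deriv_ge (c := 1 / 12) (κ := 1 / 2) (by norm_num) (by norm_num)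
    (u := fun t => F.aTilde t ^ 2 + F.cTilde t ^ 2)
    (u' := fun t => 2 * F.aTilde t * (F.Q t * F.M t)) (m := F.M) (m' := fun t => -F.rate t * F.M t)
    ((eventually_gt_atTop τ₀).mono fun t ht => (((F.hasDerivAt_aTilde ht).fun_pow 2).fun_add
      ((F.hasDerivAt_cTilde ht).fun_pow 2)).congr_deriv (by norm_num; ring))
    ((eventually_gt_atTop τ₀).mono fun t ht => F.hasDerivAt_M ht)
    (.of_forall fun t => by positivity) ((eventually_gt_atTop τ₀).mono fun t ht => F.M_pos ht)
    ?_ ?_ ?_ F.tendsto_M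
  · filter_upwards [h] with t h
    calc |F.cTilde t| ≤ √(F.aTilde t ^ 2 + F.cTilde t ^ 2) :=
          Real.abs_le_sqrt (by linarith [sq_nonneg (F.aTilde t)])
      _ ≤ 1 / 12 * (1 + 1 / (1 / 2)) * F.M t := h
      _ = F.M t / 4 := by ring
  · filter_upwards [F.tendsto_rate.eventually_const_le one_half_lt_one, eventually_gt_atTop τ₀]
      with t h ht
    have := (F.M_pos ht).le
    gcongr
  · have hQ := (tendsto_Q_of_tendsto_r hr).abs
    rw [abs_zero] at hQ
    filter_upwards [hQ.eventually_le_const (by norm_num : (0 : ℝ) < 1 / 12),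
      eventually_gt_atTop τ₀] with t h ht
    have hM := (F.M_pos ht).le
    have ha : |F.aTilde t| ≤ √(F.aTilde t ^ 2 + F.cTilde t ^ 2) :=
      Real.abs_le_sqrt (by linarith [sq_nonneg (F.cTilde t)])
    refine neg_le_of_abs_le ?_
    calc |2 * F.aTilde t * (F.Q t * F.M t)| = 2 * |F.Q t| * F.M t * |F.aTilde t| := by
          rw [abs_mul, abs_mul, abs_mul, abs_two, abs_of_nonneg hM]
          ring
      _ ≤ 2 * (1 / 12) * F.M t * √(F.aTilde t ^ 2 + F.cTilde t ^ 2) := by gcongr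
  · simpa using ((tendsto_aTilde_of_tendsto_r hr).pow 2).add
      ((tendsto_cTilde_of_tendsto_r hr).pow 2)

lemma eventually_half_mul_M_le_abs_c : ∀ᶠ t in atTop, 1 / 2 * F.M t ≤ |F.c t| := by
  have hlim : Tendsto (fun t => (1 + F.x t) * F.r t) atTop (𝓝 2) := by
    simpa using (F.tendsto_x.const_add 1).mul hr
  filter_upwards [eventually_abs_cTilde_le hr, eventually_gt_atTop τ₀,
    hlim.eventually_const_le (by norm_num : (3 / 2 : ℝ) < 2)] with t h ht hxr
  have hdrift : 3 / 2 * F.M t ≤ (1 + F.x t) * F.r t * F.M t := by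
    have := (F.M_pos ht).le
    gcongr
  unfold cTilde at h
  linarith [neg_abs_le (F.c t), (abs_le.1 h).2]

end RTendstoTwo

lemma exists_mul_X_mul_M_le_amplitude :
    ∃ δ > 0, ∀ᶠ t in atTop, δ * (F.X t * F.M t) ≤ F.amplitude t := by
  by_cases h : Tendsto (fun t => F.amplitude t / F.R t) atTop (𝓝 0)
  · refine ⟨1 / 2, one_half_pos, ?_⟩
    filter_upwards [eventually_half_mul_M_le_abs_c (F.tendsto_r_of_tendsto_amplitude_div_R h),
      eventually_gt_atTop τ₀] with t hc ht
    have hX := F.X_pos ht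
    calc 1 / 2 * (F.X t * F.M t) = 1 / 2 * F.M t * F.X t := by ring
      _ ≤ |F.c t| * F.X t := by gcongr
      _ = |F.C t| := by rw [c, abs_div, abs_of_pos hX, div_mul_cancel₀ _ hX.ne']
      _ ≤ F.amplitude t := Real.abs_le_sqrt (by linarith [sq_nonneg (F.A t)])
  · obtain ⟨δ, hδ, hle⟩ := F.exists_mul_R_le_amplitude h
    refine ⟨δ, hδ, ?_⟩
    filter_upwards [hle, F.tendsto_M.eventually_le_const one_pos, eventually_gt_atTop τ₀]
      with t h hM ht
    have hX := F.X_pos ht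
    calc δ * (F.X t * F.M t) ≤ δ * (F.X t * 1) := by gcongr
      _ ≤ δ * F.R t := by gcongr; linarith [F.two_mul_X_le ht]
      _ ≤ F.amplitude t := h

lemma tendsto_amplitude_mul_N_sq :
    Tendsto (fun t => F.amplitude t * F.N t ^ 2) atTop atTop := by
  obtain ⟨δ, hδ, hle⟩ := F.exists_mul_X_mul_M_le_amplitude
  refine tendsto_atTop_mono' _ ?_ (F.tendsto_X_mul_N.const_mul_atTop hδ)
  filter_upwards [hle, eventually_gt_atTop τ₀] with t h ht
  calc δ * (F.X t * F.N t) = δ * (F.X t * F.M t) * F.N t ^ 2 := by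
        linear_combination (-δ * F.X t * F.N t) * F.N_mul_M ht
    _ ≤ F.amplitude t * F.N t ^ 2 := by gcongr

end InvariantFlow

/-- Connection coefficients `Γ^c_{ab}`, as the entries `c`, `a`, `b`, of a class A model with
`e₁` in the kernel of `n`, where `σ = !![-2 * x, y, z; y, x + s, t; z, t, x - s]`,
`n = !![0, 0, 0; 0, p + k, l; 0, l, p - k]` and the frame rotates at the rate `(w, w₁, w₂)`. -/
def connTable (H x s t y z p k l w w₁ w₂ : ℝ) : Fin 4 → Fin 4 → Fin 4 → ℝ :=
  ![![![0, 0, 0, 0], ![0, H - 2 * x, y, z], ![0, y, H + x + s, t], ![0, z, t, H + x - s]],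
    ![![0, 0, w₂, -w₁], ![H - 2 * x, 0, 0, 0], ![y, 0, l, -k], ![z, 0, -k, -l]],
    ![![0, -w₂, 0, w], ![y, 0, 0, -p], ![H + x + s, -l, 0, 0], ![t, k, 0, 0]],
    ![![0, w₁, -w, 0], ![z, 0, p, 0], ![t, k, 0, 0], ![H + x - s, l, 0, 0]]]

/-- The Riemann tensor of an invariant orthonormal frame in terms of its connection coefficients
`Γ` and their clock time derivatives `Γ'`; the structure constants are the torsion-free
differences `Γ^f_{cd} - Γ^f_{dc}`. -/
def riemTable (Γ Γ' : Fin 4 → Fin 4 → Fin 4 → ℝ) (a b c d : Fin 4) : ℝ :=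
  (if c = 0 then Γ' a d b else 0) - (if d = 0 then Γ' a c b else 0) +
    ∑ f, (Γ f d b * Γ a c f - Γ f c b * Γ a d f - (Γ f c d - Γ f d c) * Γ a f b)

lemma hasDerivAt_connTable {H x s t y z p k l w w₁ w₂ : ℝ → ℝ}
    {H' x' s' t' y' z' p' k' l' τ : ℝ} (hH : HasDerivAt H H' τ) (hx : HasDerivAt x x' τ)
    (hs : HasDerivAt s s' τ) (ht : HasDerivAt t t' τ) (hy : HasDerivAt y y' τ)
    (hz : HasDerivAt z z' τ) (hp : HasDerivAt p p' τ) (hk : HasDerivAt k k' τ)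
    (hl : HasDerivAt l l' τ) (a b : Fin 4) (δ : Fin 3) :
    HasDerivAt (fun r => connTable (H r) (x r) (s r) (t r) (y r) (z r) (p r) (k r) (l r) (w r)
      (w₁ r) (w₂ r) a δ.succ b)
      (connTable H' x' s' t' y' z' p' k' l' 0 0 0 a δ.succ b) τ := by
  have h0 : HasDerivAt (fun _ : ℝ => (0 : ℝ)) 0 τ := hasDerivAt_const τ 0
  have h1 := hH.fun_sub (hx.const_mul 2)
  have h2 := (hH.fun_add hx).fun_add hs
  have h3 := (hH.fun_add hx).fun_sub hs
  fin_cases a <;> fin_cases δ <;> fin_cases b <;>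
    first
    | exact h0 | exact h1 | exact h2 | exact h3 | exact ht | exact hy | exact hz | exact hp
    | exact hk | exact hl | exact hk.neg | exact hl.neg | exact hp.neg

lemma mul_connTable (c H x s t y z p k l : ℝ) (a b d : Fin 4) :
    c * connTable H x s t y z p k l 0 0 0 a b d =
      connTable (c * H) (c * x) (c * s) (c * t) (c * y) (c * z) (c * p) (c * k) (c * l) 0 0 0
        a b d := by
  fin_cases a <;> fin_cases b <;> fin_cases d <;> simp [connTable] <;> ring

namespace BianchiModel

section Commutators

variable (B : BianchiModel) (τ : ℝ)

lemma eps3_swap (i j k : Fin 3) : eps3 j i k = -eps3 i j k := by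
  unfold eps3; ring

@[simp] lemma sgn_zero : sgn 0 = -1 := rfl

@[simp] lemma sgn_succ (α : Fin 3) : sgn α.succ = 1 := rfl

lemma sgn_of_ne_zero {a : Fin 4} (ha : a ≠ 0) : sgn a = 1 := by
  obtain ⟨α, rfl⟩ := Fin.exists_succ_eq.2 ha
  exact sgn_succ α

lemma sgn_mul_self (a : Fin 4) : sgn a * sgn a = 1 := by
  cases a using Fin.cases <;> simp

@[simp] lemma comm_zero (a b : Fin 4) : B.comm τ 0 a b = 0 := rfl

@[simp] lemma comm_succ_zero_zero (γ : Fin 3) : B.comm τ γ.succ 0 0 = 0 := rfl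

@[simp] lemma comm_succ_zero_succ (γ β : Fin 3) :
    B.comm τ γ.succ 0 β.succ = B.timeComm τ γ β := rfl

@[simp] lemma comm_succ_succ_zero (γ β : Fin 3) :
    B.comm τ γ.succ β.succ 0 = -B.timeComm τ γ β := rfl

@[simp] lemma comm_succ_succ_succ (γ α β : Fin 3) :
    B.comm τ γ.succ α.succ β.succ = B.spaceComm τ γ α β := rfl

lemma spaceComm_swap (γ α β : Fin 3) : B.spaceComm τ γ β α = -B.spaceComm τ γ α β := by
  simp only [spaceComm, ← Finset.sum_neg_distrib]
  exact Finset.sum_congr rfl fun δ _ => by rw [eps3_swap]; ring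

lemma comm_swap (c a b : Fin 4) : B.comm τ c b a = -B.comm τ c a b := by
  cases c using Fin.cases with
  | zero => simp
  | succ γ =>
    cases a using Fin.cases <;> cases b using Fin.cases
    case succ.succ α β => exact B.spaceComm_swap τ γ α β
    all_goals simp

lemma conn_sub_conn (c a b : Fin 4) : B.conn τ c a b - B.conn τ c b a = B.comm τ c a b := by
  simp only [conn, B.comm_swap τ c a b, B.comm_swap τ a c b, B.comm_swap τ b c a]
  linear_combination B.comm τ c a b * sgn_mul_self c

lemma conn_swap (c a b : Fin 4) : sgn b * B.conn τ b a c = -(sgn c * B.conn τ c a b) := by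
  simp only [conn, B.comm_swap τ a b c, B.comm_swap τ c a b, B.comm_swap τ b a c]
  linear_combination
    (sgn c * B.comm τ c a b - sgn a * B.comm τ a b c - sgn b * B.comm τ b a c) / 2 *
      (sgn_mul_self c - sgn_mul_self b)

lemma frameDeriv_succ (γ : Fin 3) (f : ℝ → ℝ) : B.frameDeriv γ.succ f τ = 0 := by
  simp [frameDeriv]

end Commutators

section Variables

variable (B : BianchiModel) (τ : ℝ)

/-- `H Σ₊`. -/
noncomputable def sPlus : ℝ := (B.σ τ 1 1 + B.σ τ 2 2) / 2

/-- `√3 H Σ₋`. -/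
noncomputable def sMinus : ℝ := (B.σ τ 1 1 - B.σ τ 2 2) / 2

/-- `√3 H Σ_×`. -/
def sCross : ℝ := B.σ τ 1 2

/-- `H N₊`. -/
noncomputable def nPlus : ℝ := (B.n τ 1 1 + B.n τ 2 2) / 2

/-- `√3 H N₋`. -/
noncomputable def nMinus : ℝ := (B.n τ 1 1 - B.n τ 2 2) / 2

/-- `√3 H N_×`. -/
def nCross : ℝ := B.n τ 1 2

end Variables

variable {B : BianchiModel} {τ₀ τ : ℝ}

lemma σ_eq (hB : B.IsRadiationVII0 τ₀) (ht : τ > τ₀) :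
    B.σ τ = !![-2 * B.sPlus τ, B.σ τ 0 1, B.σ τ 0 2;
      B.σ τ 0 1, B.sPlus τ + B.sMinus τ, B.sCross τ;
      B.σ τ 0 2, B.sCross τ, B.sPlus τ - B.sMinus τ] := by
  have hs := fun i j => (hB.σ_symm τ ht).apply i j
  have htr : B.σ τ 0 0 = -B.σ τ 1 1 - B.σ τ 2 2 := by
    have := hB.σ_trace τ ht
    rw [Matrix.trace_fin_three] at this
    linarith
  ext i j
  fin_cases i <;> fin_cases j <;>
    simp [sPlus, sMinus, sCross, htr, hs 0 1, hs 0 2, hs 1 2] <;> ring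

lemma n_eq (hB : B.IsRadiationVII0 τ₀) (ht : τ > τ₀) :
    B.n τ = !![0, 0, 0; 0, B.nPlus τ + B.nMinus τ, B.nCross τ;
      0, B.nCross τ, B.nPlus τ - B.nMinus τ] := by
  have hn := fun i j => (hB.n_symm τ ht).apply i j
  have hk := hB.n_ker τ ht
  ext i j
  fin_cases i <;> fin_cases j <;>
    simp [nPlus, nMinus, nCross, hk, (hn 0 1).trans (hk 1), (hn 0 2).trans (hk 2), hn 1 2] <;> ring

lemma conn_eq (hB : B.IsRadiationVII0 τ₀) (ht : τ > τ₀) :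
    B.conn τ = connTable (B.H τ) (B.sPlus τ) (B.sMinus τ) (B.sCross τ) (B.σ τ 0 1) (B.σ τ 0 2)
      (B.nPlus τ) (B.nMinus τ) (B.nCross τ) (B.ω τ 0) (B.ω τ 1) (B.ω τ 2) := by
  have hσ := σ_eq hB ht
  generalize B.σ τ 0 1 = y, B.σ τ 0 2 = z at hσ ⊢
  funext c a b
  cases c using Fin.cases <;> cases a using Fin.cases <;> cases b using Fin.cases <;>
    simp only [conn, comm_zero, comm_succ_zero_zero, comm_succ_zero_succ, comm_succ_succ_zero,
      comm_succ_succ_succ, sgn_zero, sgn_succ, timeComm, spaceComm, hσ, n_eq hB ht]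
  case zero.zero.zero => simp [connTable]
  case zero.zero.succ β => fin_cases β <;> simp [connTable]
  case zero.succ.zero α => fin_cases α <;> simp [connTable]
  case succ.zero.zero γ => fin_cases γ <;> simp [connTable]
  case zero.succ.succ α β =>
    fin_cases α <;> fin_cases β <;> simp [connTable, eps3, Fin.sum_univ_three] <;> ring
  case succ.zero.succ γ β =>
    fin_cases γ <;> fin_cases β <;> simp [connTable, eps3, Fin.sum_univ_three] <;> ring
  case succ.succ.zero γ α =>
    fin_cases γ <;> fin_cases α <;> simp [connTable, eps3, Fin.sum_univ_three] <;> ring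
  case succ.succ.succ γ α β =>
    fin_cases γ <;> fin_cases α <;> fin_cases β <;>
      simp [connTable, eps3, Fin.sum_univ_three] <;> ring

section Differentiability

lemma differentiableAt_sPlus (hB : B.IsRadiationVII0 τ₀) (ht : τ > τ₀) :
    DifferentiableAt ℝ B.sPlus τ :=
  ((hB.σ_diff τ ht 1 1).fun_add (hB.σ_diff τ ht 2 2)).div_const 2

lemma differentiableAt_sMinus (hB : B.IsRadiationVII0 τ₀) (ht : τ > τ₀) :
    DifferentiableAt ℝ B.sMinus τ :=
  ((hB.σ_diff τ ht 1 1).fun_sub (hB.σ_diff τ ht 2 2)).div_const 2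

lemma differentiableAt_sCross (hB : B.IsRadiationVII0 τ₀) (ht : τ > τ₀) :
    DifferentiableAt ℝ B.sCross τ :=
  hB.σ_diff τ ht 1 2

lemma differentiableAt_nPlus (hB : B.IsRadiationVII0 τ₀) (ht : τ > τ₀) :
    DifferentiableAt ℝ B.nPlus τ :=
  ((hB.n_diff τ ht 1 1).fun_add (hB.n_diff τ ht 2 2)).div_const 2

lemma differentiableAt_nMinus (hB : B.IsRadiationVII0 τ₀) (ht : τ > τ₀) :
    DifferentiableAt ℝ B.nMinus τ :=
  ((hB.n_diff τ ht 1 1).fun_sub (hB.n_diff τ ht 2 2)).div_const 2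

lemma differentiableAt_nCross (hB : B.IsRadiationVII0 τ₀) (ht : τ > τ₀) :
    DifferentiableAt ℝ B.nCross τ :=
  hB.n_diff τ ht 1 2

end Differentiability

section Curvature

/-- The clock time derivatives of the connection coefficients `Γ^c_{ab}` with `a ≠ 0`. The angular
velocity of the frame, which need not be differentiable, enters only those with `a = 0`; their
entries here are junk. -/
noncomputable def connDeriv (B : BianchiModel) (τ : ℝ) : Fin 4 → Fin 4 → Fin 4 → ℝ :=
  connTable (B.H τ * deriv B.H τ) (B.H τ * deriv B.sPlus τ) (B.H τ * deriv B.sMinus τ)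
    (B.H τ * deriv B.sCross τ) (B.H τ * deriv (fun r => B.σ r 0 1) τ)
    (B.H τ * deriv (fun r => B.σ r 0 2) τ) (B.H τ * deriv B.nPlus τ)
    (B.H τ * deriv B.nMinus τ) (B.H τ * deriv B.nCross τ) 0 0 0

lemma hasDerivAt_conn (hB : B.IsRadiationVII0 τ₀) (ht : τ > τ₀) (a b : Fin 4) (δ : Fin 3) :
    HasDerivAt (fun r => B.conn r a δ.succ b) (B.connDeriv τ a δ.succ b / B.H τ) τ := by
  have he : (fun r => B.conn r a δ.succ b) =ᶠ[𝓝 τ] fun r => connTable (B.H r) (B.sPlus r)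
      (B.sMinus r) (B.sCross r) (B.σ r 0 1) (B.σ r 0 2) (B.nPlus r) (B.nMinus r) (B.nCross r)
      (B.ω r 0) (B.ω r 1) (B.ω r 2) a δ.succ b := by
    filter_upwards [eventually_gt_nhds ht] with r hr
    rw [conn_eq hB hr]
  have hd := hasDerivAt_connTable (w := fun r => B.ω r 0) (w₁ := fun r => B.ω r 1)
    (w₂ := fun r => B.ω r 2) (hB.H_diff τ ht).hasDerivAt (differentiableAt_sPlus hB ht).hasDerivAt
    (differentiableAt_sMinus hB ht).hasDerivAt (differentiableAt_sCross hB ht).hasDerivAt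
    (hB.σ_diff τ ht 0 1).hasDerivAt (hB.σ_diff τ ht 0 2).hasDerivAt
    (differentiableAt_nPlus hB ht).hasDerivAt (differentiableAt_nMinus hB ht).hasDerivAt
    (differentiableAt_nCross hB ht).hasDerivAt a b δ
  refine (hd.congr_of_eventuallyEq he).congr_deriv ?_
  rw [eq_div_iff (hB.H_pos τ ht).ne', mul_comm, mul_connTable, connDeriv]

lemma frameDeriv_conn (hB : B.IsRadiationVII0 τ₀) (ht : τ > τ₀) (a b : Fin 4) (δ : Fin 3) :
    B.frameDeriv 0 (fun r => B.conn r a δ.succ b) τ = B.connDeriv τ a δ.succ b := by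
  rw [frameDeriv, if_pos rfl, (hasDerivAt_conn hB ht a b δ).deriv,
    mul_div_cancel₀ _ (hB.H_pos τ ht).ne']

lemma riem_eq (hB : B.IsRadiationVII0 τ₀) (ht : τ > τ₀) :
    B.riem τ = riemTable (B.conn τ) (B.connDeriv τ) := by
  funext a b c d
  simp only [riem, riemTable, conn_sub_conn]
  congr 1
  cases c using Fin.cases <;> cases d using Fin.cases <;>
    simp [frameDeriv_succ, frameDeriv_conn hB ht]

lemma jacobi_zero_succ_succ (hB : B.IsRadiationVII0 τ₀) (ht : τ > τ₀) (β γ : Fin 3) (d : Fin 4) :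
    B.connDeriv τ d β.succ γ.succ - B.connDeriv τ d γ.succ β.succ +
      ∑ f, ((B.conn τ f β.succ γ.succ - B.conn τ f γ.succ β.succ) *
          (B.conn τ d 0 f - B.conn τ d f 0) +
        (B.conn τ f γ.succ 0 - B.conn τ f 0 γ.succ) *
          (B.conn τ d β.succ f - B.conn τ d f β.succ) +
        (B.conn τ f 0 β.succ - B.conn τ f β.succ 0) *
          (B.conn τ d γ.succ f - B.conn τ d f γ.succ)) = 0 := by
  have hd : ∀ β γ : Fin 3, DifferentiableAt ℝ (fun r => B.conn r d β.succ γ.succ) τ :=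
    fun β γ => (hasDerivAt_conn hB ht d γ.succ β).differentiableAt
  have hcomm : B.frameDeriv 0 (fun r => B.comm r d β.succ γ.succ) τ =
      B.connDeriv τ d β.succ γ.succ - B.connDeriv τ d γ.succ β.succ := by
    rw [← frameDeriv_conn hB ht, ← frameDeriv_conn hB ht]
    simp only [← conn_sub_conn, frameDeriv, if_pos]
    rw [deriv_fun_sub (hd _ _) (hd _ _), mul_sub]
  have hjac := hB.jacobi τ ht 0 β.succ γ.succ d
  rw [frameDeriv_succ, frameDeriv_succ, hcomm] at hjac
  simp only [conn_sub_conn, Finset.sum_add_distrib]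
  linarith

end Curvature

section Stress

lemma eq_zero_of_det_pos {a b c p q : ℝ} (hdet : 0 < a * c - b ^ 2) (h1 : a * p + b * q = 0)
    (h2 : b * p + c * q = 0) : p = 0 ∧ q = 0 := by
  constructor
  · refine (mul_eq_zero.1 (?_ : (a * c - b ^ 2) * p = 0)).resolve_left hdet.ne'
    linear_combination c * h1 - b * h2
  · refine (mul_eq_zero.1 (?_ : (a * c - b ^ 2) * q = 0)).resolve_left hdet.ne'
    linear_combination a * h2 - b * h1

lemma eq_zero_of_quadratic_form_eq_zero {a b c p q : ℝ} (hdet : 0 < a * c - b ^ 2)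
    (h : a * p ^ 2 + 2 * b * p * q + c * q ^ 2 = 0) : p = 0 ∧ q = 0 := by
  have hsq : (a * p + b * q) ^ 2 + (a * c - b ^ 2) * q ^ 2 = 0 := by linear_combination a * h
  have hsq' : (b * p + c * q) ^ 2 + (a * c - b ^ 2) * p ^ 2 = 0 := by linear_combination c * h
  refine eq_zero_of_det_pos hdet ?_ ?_ <;> nlinarith [sq_nonneg p, sq_nonneg q]

lemma n_det_pos (hB : B.IsRadiationVII0 τ₀) (ht : τ > τ₀) :
    0 < (B.nPlus τ + B.nMinus τ) * (B.nPlus τ - B.nMinus τ) - B.nCross τ ^ 2 := by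
  convert hB.typeVII τ ht using 1
  rw [nPlus, nMinus, nCross]
  ring

/-- The spatial part of the irrotationality condition is a quadratic form in `(v₂, v₃)` whose
matrix is the definite block of `n`. -/
lemma tilt_eq_zero (hB : B.IsRadiationVII0 τ₀) (ht : τ > τ₀) : B.v τ 1 = 0 ∧ B.v τ 2 = 0 := by
  have hq : 0 < √(1 - ∑ α, B.v τ α ^ 2) := Real.sqrt_pos.2 (by linarith [hB.v_lt_one τ ht])
  have hcov (a b : Fin 3) :
      B.covU τ a.succ b.succ = -∑ c, B.conn τ c a.succ b.succ * B.u τ c := by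
    simp [covU, frameDeriv_succ]
  have hu (α : Fin 3) : B.u τ α.succ = B.v τ α / √(1 - ∑ α, B.v τ α ^ 2) := rfl
  generalize √(1 - ∑ α, B.v τ α ^ 2) = q at hq hu
  have h := hB.irrotational τ ht (0 : Fin 3).succ (1 : Fin 3).succ (2 : Fin 3).succ
  simp only [hcov, Fin.sum_univ_succ, hu, conn_eq hB ht] at h
  simp only [connTable, Fin.succ_one_eq_two, Fin.reduceSucc, Fin.succ_zero_eq_one, Matrix.cons_val,
    Matrix.cons_val', Matrix.cons_val_fin_one, Matrix.cons_val_zero, Matrix.cons_val_one,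
    Matrix.cons_val_succ, Finset.univ_eq_empty, Finset.sum_empty, zero_mul, add_zero] at h
  field_simp at h
  refine eq_zero_of_quadratic_form_eq_zero (n_det_pos hB ht) ?_
  linear_combination -h

/-- `μ Γ²`, where `Γ` is the Lorentz factor of the tilt along `e₁`. -/
noncomputable def boosted (B : BianchiModel) (τ : ℝ) : ℝ := B.μ τ / (1 - B.v τ 0 ^ 2)

lemma sum_tilt_sq (hB : B.IsRadiationVII0 τ₀) (ht : τ > τ₀) :
    ∑ α, B.v τ α ^ 2 = B.v τ 0 ^ 2 := by
  obtain ⟨h1, h2⟩ := tilt_eq_zero hB ht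
  simp [Fin.sum_univ_three, h1, h2]

lemma tilt_sq_lt_one (hB : B.IsRadiationVII0 τ₀) (ht : τ > τ₀) : B.v τ 0 ^ 2 < 1 := by
  rw [← sum_tilt_sq hB ht]
  exact hB.v_lt_one τ ht

lemma stress_eq (hB : B.IsRadiationVII0 τ₀) (ht : τ > τ₀) (a b : Fin 4) :
    B.stress τ a b = B.boosted τ * (4 * ![-1, B.v τ 0, 0, 0] a * ![-1, B.v τ 0, 0, 0] b +
      (1 - B.v τ 0 ^ 2) * g a b) / 3 := by
  obtain ⟨hv1, hv2⟩ := tilt_eq_zero hB ht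
  have hpos : 0 < 1 - B.v τ 0 ^ 2 := by linarith [tilt_sq_lt_one hB ht]
  have hu (a : Fin 4) : B.u τ a = ![-1, B.v τ 0, 0, 0] a / √(1 - B.v τ 0 ^ 2) := by
    rw [← sum_tilt_sq hB ht, u]
    congr 1
    fin_cases a
    exacts [rfl, rfl, hv1, hv2]
  have huu : B.u τ a * B.u τ b =
      ![-1, B.v τ 0, 0, 0] a * ![-1, B.v τ 0, 0, 0] b / (1 - B.v τ 0 ^ 2) := by
    rw [hu, hu, div_mul_div_comm, Real.mul_self_sqrt hpos.le]
  rw [stress, mul_assoc, huu, boosted]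
  field_simp
  ring

lemma stress_trace_eq_zero (hB : B.IsRadiationVII0 τ₀) (ht : τ > τ₀) :
    ∑ a, sgn a * B.stress τ a a = 0 := by
  simp [Fin.sum_univ_succ, stress_eq hB ht, g]
  ring

lemma scalar_eq_zero (hB : B.IsRadiationVII0 τ₀) (ht : τ > τ₀) : B.scalar τ = 0 := by
  have hg (a : Fin 4) : sgn a * g a a = 1 := by simp [g, sgn_mul_self]
  have h : ∑ a, sgn a * (B.ricci τ a a - B.scalar τ / 2 * g a a) = 0 := by
    simpa only [hB.einstein τ ht _ _] using stress_trace_eq_zero hB ht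
  simp only [mul_sub, Finset.sum_sub_distrib, mul_left_comm _ (B.scalar τ / 2), hg, mul_one,
    Finset.sum_const, Finset.card_univ, Fintype.card_fin, nsmul_eq_mul] at h
  rw [← scalar] at h
  push_cast at h
  linarith

lemma ricci_eq_stress (hB : B.IsRadiationVII0 τ₀) (ht : τ > τ₀) (a b : Fin 4) :
    B.ricci τ a b = B.stress τ a b := by
  simpa [scalar_eq_zero hB ht] using hB.einstein τ ht a b

end Stress

section FieldEquations

lemma ricci_zero_two (hB : B.IsRadiationVII0 τ₀) (ht : τ > τ₀) :
    B.ricci τ 0 2 = -(B.nCross τ * B.σ τ 0 1 + (B.nPlus τ - B.nMinus τ) * B.σ τ 0 2) := by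
  simp [ricci, riem_eq hB ht, conn_eq hB ht, riemTable, connTable, connDeriv, Fin.sum_univ_four]
  ring

lemma ricci_zero_three (hB : B.IsRadiationVII0 τ₀) (ht : τ > τ₀) :
    B.ricci τ 0 3 = (B.nPlus τ + B.nMinus τ) * B.σ τ 0 1 + B.nCross τ * B.σ τ 0 2 := by
  simp [ricci, riem_eq hB ht, conn_eq hB ht, riemTable, connTable, connDeriv, Fin.sum_univ_four]
  ring

/-- These are the momentum constraints along `e₂` and `e₃`, directions of no energy flux. -/
lemma shear_eq_zero (hB : B.IsRadiationVII0 τ₀) (ht : τ > τ₀) :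
    B.σ τ 0 1 = 0 ∧ B.σ τ 0 2 = 0 := by
  have h2 : B.ricci τ 0 2 = 0 := by simp [ricci_eq_stress hB ht, stress_eq hB ht, g]
  have h3 : B.ricci τ 0 3 = 0 := by simp [ricci_eq_stress hB ht, stress_eq hB ht, g]
  rw [ricci_zero_two hB ht] at h2
  rw [ricci_zero_three hB ht] at h3
  exact eq_zero_of_det_pos (n_det_pos hB ht) h3 (neg_eq_zero.1 h2)

/-- The Jacobi identities of `e₀, e₂, e₃` then keep the kernel of `n` along `e₁` only if the frame
does not rotate out of it. -/
lemma spin_eq_zero (hB : B.IsRadiationVII0 τ₀) (ht : τ > τ₀) :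
    B.ω τ 1 = 0 ∧ B.ω τ 2 = 0 := by
  obtain ⟨hy, hz⟩ := shear_eq_zero hB ht
  have h2 : (B.nPlus τ + B.nMinus τ) * B.ω τ 2 + B.nCross τ * -B.ω τ 1 = 0 := by
    have := jacobi_zero_succ_succ hB ht 1 2 2
    simp [Fin.sum_univ_four, conn_eq hB ht, connTable, connDeriv, hy, hz] at this
    linarith
  have h3 : B.nCross τ * B.ω τ 2 + (B.nPlus τ - B.nMinus τ) * -B.ω τ 1 = 0 := by
    have := jacobi_zero_succ_succ hB ht 1 2 3
    simp [Fin.sum_univ_four, conn_eq hB ht, connTable, connDeriv, hy, hz] at this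
    linarith
  have := eq_zero_of_det_pos (n_det_pos hB ht) h2 h3
  exact ⟨neg_eq_zero.1 this.2, this.1⟩

lemma conn_eq_block (hB : B.IsRadiationVII0 τ₀) (ht : τ > τ₀) :
    B.conn τ = connTable (B.H τ) (B.sPlus τ) (B.sMinus τ) (B.sCross τ) 0 0 (B.nPlus τ)
      (B.nMinus τ) (B.nCross τ) (B.ω τ 0) 0 0 := by
  obtain ⟨hy, hz⟩ := shear_eq_zero hB ht
  obtain ⟨h1, h2⟩ := spin_eq_zero hB ht
  rw [conn_eq hB ht, hy, hz, h1, h2]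

lemma connDeriv_eq_block (hB : B.IsRadiationVII0 τ₀) (ht : τ > τ₀) :
    B.connDeriv τ = connTable (B.H τ * deriv B.H τ) (B.H τ * deriv B.sPlus τ)
      (B.H τ * deriv B.sMinus τ) (B.H τ * deriv B.sCross τ) 0 0 (B.H τ * deriv B.nPlus τ)
      (B.H τ * deriv B.nMinus τ) (B.H τ * deriv B.nCross τ) 0 0 0 := by
  have hy : (fun r => B.σ r 0 1) =ᶠ[𝓝 τ] fun _ => 0 := by
    filter_upwards [eventually_gt_nhds ht] with r hr using (shear_eq_zero hB hr).1
  have hz : (fun r => B.σ r 0 2) =ᶠ[𝓝 τ] fun _ => 0 := by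
    filter_upwards [eventually_gt_nhds ht] with r hr using (shear_eq_zero hB hr).2
  simp [connDeriv, hy.deriv_eq, hz.deriv_eq]

lemma stress_zero_zero (hB : B.IsRadiationVII0 τ₀) (ht : τ > τ₀) :
    B.stress τ 0 0 = B.boosted τ * (3 + B.v τ 0 ^ 2) / 3 := by
  rw [stress_eq hB ht, g, if_pos rfl, sgn_zero, Matrix.cons_val_zero]
  ring

lemma einstein_zero_zero (hB : B.IsRadiationVII0 τ₀) (ht : τ > τ₀) :
    B.boosted τ * (3 + B.v τ 0 ^ 2) / 3 = -3 * (B.H τ * deriv B.H τ) - 3 * B.H τ ^ 2 -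
      2 * (B.sMinus τ ^ 2 + B.sCross τ ^ 2 + 3 * B.sPlus τ ^ 2) := by
  have h := ricci_eq_stress hB ht 0 0
  simp [ricci, riem_eq hB ht, conn_eq_block hB ht, connDeriv_eq_block hB ht, riemTable, connTable,
    Fin.sum_univ_four, stress_eq hB ht, g] at h
  linarith

lemma einstein_zero_one (hB : B.IsRadiationVII0 τ₀) (ht : τ > τ₀) :
    2 / 3 * B.boosted τ * B.v τ 0 = B.sCross τ * B.nMinus τ - B.sMinus τ * B.nCross τ := by
  have h := ricci_eq_stress hB ht 0 1
  simp [ricci, riem_eq hB ht, conn_eq_block hB ht, connDeriv_eq_block hB ht, riemTable, connTable,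
    Fin.sum_univ_four, stress_eq hB ht, g] at h
  linarith

lemma einstein_one_one (hB : B.IsRadiationVII0 τ₀) (ht : τ > τ₀) :
    B.boosted τ * (1 + 3 * B.v τ 0 ^ 2) / 3 = B.H τ * deriv B.H τ - 2 * (B.H τ * deriv B.sPlus τ) +
      3 * B.H τ ^ 2 - 6 * B.H τ * B.sPlus τ - 2 * (B.nMinus τ ^ 2 + B.nCross τ ^ 2) := by
  have h := ricci_eq_stress hB ht 1 1
  simp [ricci, riem_eq hB ht, conn_eq_block hB ht, connDeriv_eq_block hB ht, riemTable, connTable,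
    Fin.sum_univ_four, stress_eq hB ht, g, sgn_of_ne_zero] at h
  linarith

lemma einstein_two_two (hB : B.IsRadiationVII0 τ₀) (ht : τ > τ₀) :
    B.boosted τ * (1 - B.v τ 0 ^ 2) / 3 = B.H τ * deriv B.H τ + B.H τ * deriv B.sPlus τ +
      B.H τ * deriv B.sMinus τ + 3 * B.H τ ^ 2 + 3 * B.H τ * (B.sPlus τ + B.sMinus τ) +
      2 * B.nPlus τ * B.nMinus τ + 2 * B.sCross τ * B.ω τ 0 := by
  have h := ricci_eq_stress hB ht 2 2
  simp [ricci, riem_eq hB ht, conn_eq_block hB ht, connDeriv_eq_block hB ht, riemTable, connTable,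
    Fin.sum_univ_four, stress_eq hB ht, g, sgn_of_ne_zero] at h
  linarith

lemma einstein_three_three (hB : B.IsRadiationVII0 τ₀) (ht : τ > τ₀) :
    B.boosted τ * (1 - B.v τ 0 ^ 2) / 3 = B.H τ * deriv B.H τ + B.H τ * deriv B.sPlus τ -
      B.H τ * deriv B.sMinus τ + 3 * B.H τ ^ 2 + 3 * B.H τ * (B.sPlus τ - B.sMinus τ) -
      2 * B.nPlus τ * B.nMinus τ - 2 * B.sCross τ * B.ω τ 0 := by
  have h := ricci_eq_stress hB ht 3 3
  simp [ricci, riem_eq hB ht, conn_eq_block hB ht, connDeriv_eq_block hB ht, riemTable, connTable,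
    Fin.sum_univ_four, stress_eq hB ht, g, sgn_of_ne_zero] at h
  linarith

lemma gauss_constraint (hB : B.IsRadiationVII0 τ₀) (ht : τ > τ₀) :
    3 * B.H τ ^ 2 = B.boosted τ * (3 + B.v τ 0 ^ 2) / 3 + B.sMinus τ ^ 2 + B.sCross τ ^ 2 +
      B.nMinus τ ^ 2 + B.nCross τ ^ 2 + 3 * B.sPlus τ ^ 2 := by
  linarith [einstein_zero_zero hB ht, einstein_one_one hB ht, einstein_two_two hB ht,
    einstein_three_three hB ht]

lemma H_mul_deriv_H (hB : B.IsRadiationVII0 τ₀) (ht : τ > τ₀) :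
    B.H τ * deriv B.H τ = -2 * B.H τ ^ 2 - (B.sMinus τ ^ 2 + B.sCross τ ^ 2 +
      3 * B.sPlus τ ^ 2 - B.nMinus τ ^ 2 - B.nCross τ ^ 2) / 3 := by
  linarith [einstein_zero_zero hB ht, einstein_one_one hB ht, einstein_two_two hB ht,
    einstein_three_three hB ht]

lemma H_mul_deriv_sPlus (hB : B.IsRadiationVII0 τ₀) (ht : τ > τ₀) :
    B.H τ * deriv B.sPlus τ = -3 * B.H τ * B.sPlus τ -
      2 / 3 * (B.nMinus τ ^ 2 + B.nCross τ ^ 2) - 4 / 9 * B.boosted τ * B.v τ 0 ^ 2 := by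
  linarith [einstein_zero_zero hB ht, einstein_one_one hB ht, einstein_two_two hB ht,
    einstein_three_three hB ht]

lemma H_mul_deriv_sMinus (hB : B.IsRadiationVII0 τ₀) (ht : τ > τ₀) :
    B.H τ * deriv B.sMinus τ =
      -3 * B.H τ * B.sMinus τ - 2 * B.nPlus τ * B.nMinus τ - 2 * B.ω τ 0 * B.sCross τ := by
  linarith [einstein_two_two hB ht, einstein_three_three hB ht]

lemma H_mul_deriv_sCross (hB : B.IsRadiationVII0 τ₀) (ht : τ > τ₀) :
    B.H τ * deriv B.sCross τ =
      -3 * B.H τ * B.sCross τ - 2 * B.nPlus τ * B.nCross τ + 2 * B.ω τ 0 * B.sMinus τ := by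
  have h := ricci_eq_stress hB ht 2 3
  simp [ricci, riem_eq hB ht, conn_eq_block hB ht, connDeriv_eq_block hB ht, riemTable, connTable,
    Fin.sum_univ_four, stress_eq hB ht, g] at h
  linarith

lemma jacobi_nPlus_add_nMinus (hB : B.IsRadiationVII0 τ₀) (ht : τ > τ₀) :
    B.H τ * deriv B.nPlus τ + B.H τ * deriv B.nMinus τ =
      (-B.H τ + 2 * B.sPlus τ + 2 * B.sMinus τ) * (B.nPlus τ + B.nMinus τ) +
      2 * (B.sCross τ - B.ω τ 0) * B.nCross τ := by
  have h := jacobi_zero_succ_succ hB ht 2 0 2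
  simp [Fin.sum_univ_four, conn_eq_block hB ht, connDeriv_eq_block hB ht, connTable] at h
  linarith

lemma jacobi_nPlus_sub_nMinus (hB : B.IsRadiationVII0 τ₀) (ht : τ > τ₀) :
    B.H τ * deriv B.nPlus τ - B.H τ * deriv B.nMinus τ =
      (-B.H τ + 2 * B.sPlus τ - 2 * B.sMinus τ) * (B.nPlus τ - B.nMinus τ) +
      2 * (B.sCross τ + B.ω τ 0) * B.nCross τ := by
  have h := jacobi_zero_succ_succ hB ht 0 1 3
  simp [Fin.sum_univ_four, conn_eq_block hB ht, connDeriv_eq_block hB ht, connTable] at h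
  linarith

lemma H_mul_deriv_nPlus (hB : B.IsRadiationVII0 τ₀) (ht : τ > τ₀) :
    B.H τ * deriv B.nPlus τ = -B.H τ * B.nPlus τ + 2 * B.sPlus τ * B.nPlus τ +
      2 * (B.sMinus τ * B.nMinus τ + B.sCross τ * B.nCross τ) := by
  linarith [jacobi_nPlus_add_nMinus hB ht, jacobi_nPlus_sub_nMinus hB ht]

lemma H_mul_deriv_nMinus (hB : B.IsRadiationVII0 τ₀) (ht : τ > τ₀) :
    B.H τ * deriv B.nMinus τ = -B.H τ * B.nMinus τ + 2 * B.sPlus τ * B.nMinus τ +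
      2 * B.nPlus τ * B.sMinus τ - 2 * B.ω τ 0 * B.nCross τ := by
  linarith [jacobi_nPlus_add_nMinus hB ht, jacobi_nPlus_sub_nMinus hB ht]

lemma H_mul_deriv_nCross (hB : B.IsRadiationVII0 τ₀) (ht : τ > τ₀) :
    B.H τ * deriv B.nCross τ = -B.H τ * B.nCross τ + 2 * B.sPlus τ * B.nCross τ +
      2 * B.nPlus τ * B.sCross τ + 2 * B.ω τ 0 * B.nMinus τ := by
  have h := jacobi_zero_succ_succ hB ht 0 1 2
  simp [Fin.sum_univ_four, conn_eq_block hB ht, connDeriv_eq_block hB ht, connTable] at h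
  linarith

end FieldEquations

section Normalized

variable (B τ)

/-- `Σ₊ = (Σ₂₂ + Σ₃₃) / 2`. -/
noncomputable def Sp : ℝ := (B.Sh τ 1 1 + B.Sh τ 2 2) / 2

/-- `𝓡₂ cos 2ψ`. -/
noncomputable def polarCos : ℝ := B.Sm τ ^ 2 + B.Sx τ ^ 2 - B.Nm τ ^ 2 - B.Nx τ ^ 2

/-- `𝓡₂ sin 2ψ`. -/
noncomputable def polarSin : ℝ := 2 * (B.Sm τ * B.Nm τ + B.Sx τ * B.Nx τ)

/-- `Σ_× N₋ - Σ₋ N_×`, which the Codazzi constraint identifies with the energy flux. -/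
noncomputable def wedge : ℝ := B.Sx τ * B.Nm τ - B.Sm τ * B.Nx τ

lemma Sp_eq : B.Sp τ = B.sPlus τ / B.H τ := by
  rw [Sp, Sh, Sh, sPlus]; ring

lemma Sm_eq : B.Sm τ = B.sMinus τ / B.H τ / √3 := by
  rw [Sm, Sh, Sh, sMinus]; ring

lemma Sx_eq : B.Sx τ = B.sCross τ / B.H τ / √3 := rfl

lemma Np_eq : B.Np τ = B.nPlus τ / B.H τ := by
  rw [Np, N, N, nPlus]; ring

lemma Nm_eq : B.Nm τ = B.nMinus τ / B.H τ / √3 := by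
  rw [Nm, N, N, nMinus]; ring

lemma Nx_eq : B.Nx τ = B.nCross τ / B.H τ / √3 := rfl

lemma R1_sq : B.R1 τ ^ 2 = B.polarCos τ ^ 2 + B.polarSin τ ^ 2 + 4 * B.wedge τ ^ 2 := by
  rw [R1, polarCos, polarSin, wedge]; ring

lemma R1_sub_polarCos : B.R1 τ - B.polarCos τ = 2 * (B.Nm τ ^ 2 + B.Nx τ ^ 2) := by
  rw [R1, polarCos]; ring

lemma R1_add_polarCos : B.R1 τ + B.polarCos τ = 2 * (B.Sm τ ^ 2 + B.Sx τ ^ 2) := by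
  rw [R1, polarCos]; ring

end Normalized

section NormalizedRelations

lemma sPlus_eq (hB : B.IsRadiationVII0 τ₀) (ht : τ > τ₀) : B.sPlus τ = B.H τ * B.Sp τ := by
  rw [Sp_eq, mul_div_cancel₀ _ (hB.H_pos τ ht).ne']

lemma sMinus_eq (hB : B.IsRadiationVII0 τ₀) (ht : τ > τ₀) :
    B.sMinus τ = √3 * (B.H τ * B.Sm τ) := by
  have := (hB.H_pos τ ht).ne'
  rw [Sm_eq]; field_simp

lemma sCross_eq (hB : B.IsRadiationVII0 τ₀) (ht : τ > τ₀) :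
    B.sCross τ = √3 * (B.H τ * B.Sx τ) := by
  have := (hB.H_pos τ ht).ne'
  rw [Sx_eq]; field_simp

lemma nPlus_eq (hB : B.IsRadiationVII0 τ₀) (ht : τ > τ₀) : B.nPlus τ = B.H τ * B.Np τ := by
  rw [Np_eq, mul_div_cancel₀ _ (hB.H_pos τ ht).ne']

lemma nMinus_eq (hB : B.IsRadiationVII0 τ₀) (ht : τ > τ₀) :
    B.nMinus τ = √3 * (B.H τ * B.Nm τ) := by
  have := (hB.H_pos τ ht).ne'
  rw [Nm_eq]; field_simp

lemma nCross_eq (hB : B.IsRadiationVII0 τ₀) (ht : τ > τ₀) :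
    B.nCross τ = √3 * (B.H τ * B.Nx τ) := by
  have := (hB.H_pos τ ht).ne'
  rw [Nx_eq]; field_simp

lemma boosted_eq (hB : B.IsRadiationVII0 τ₀) (ht : τ > τ₀) :
    B.boosted τ = 9 * B.H τ ^ 2 * B.Ω τ / (3 + B.v τ 0 ^ 2) := by
  have := (hB.H_pos τ ht).ne'
  have h3 : 3 + B.v τ 0 ^ 2 ≠ 0 := by positivity
  rw [Ω, stress_zero_zero hB ht]
  field_simp
  norm_num

lemma sqrt_three_sq : √3 ^ 2 = (3 : ℝ) := Real.sq_sqrt (by norm_num)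

lemma Ω_eq (hB : B.IsRadiationVII0 τ₀) (ht : τ > τ₀) :
    B.Ω τ = 1 - B.Sp τ ^ 2 - B.R1 τ := by
  have hH := (hB.H_pos τ ht).ne'
  have h := gauss_constraint hB ht
  rw [← stress_zero_zero hB ht, sMinus_eq hB ht, sCross_eq hB ht, nMinus_eq hB ht,
    nCross_eq hB ht, sPlus_eq hB ht] at h
  simp only [mul_pow, sqrt_three_sq] at h
  rw [Ω, R1]
  field_simp
  linarith

lemma wedge_eq (hB : B.IsRadiationVII0 τ₀) (ht : τ > τ₀) :
    B.wedge τ = 2 * B.v τ 0 * B.Ω τ / (3 + B.v τ 0 ^ 2) := by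
  have hH := (hB.H_pos τ ht).ne'
  have h := einstein_zero_one hB ht
  rw [boosted_eq hB ht, sMinus_eq hB ht, sCross_eq hB ht, nMinus_eq hB ht, nCross_eq hB ht] at h
  rw [wedge]
  apply mul_left_cancel₀ (pow_ne_zero 2 hH)
  linear_combination (-1 / 3) * h -
    (B.Sx τ * B.Nm τ - B.Sm τ * B.Nx τ) * B.H τ ^ 2 / 3 * sqrt_three_sq

lemma Np_sq_gt (hB : B.IsRadiationVII0 τ₀) (ht : τ > τ₀) :
    3 / 2 * (B.R1 τ - B.polarCos τ) < B.Np τ ^ 2 := by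
  have h := n_det_pos hB ht
  rw [nPlus_eq hB ht, nMinus_eq hB ht, nCross_eq hB ht] at h
  have : 0 < B.H τ ^ 2 * (B.Np τ ^ 2 - 3 / 2 * (B.R1 τ - B.polarCos τ)) := by
    rw [R1_sub_polarCos]
    linear_combination h - B.H τ ^ 2 * (B.Nm τ ^ 2 + B.Nx τ ^ 2) * sqrt_three_sq
  linarith [pos_of_mul_pos_right this (sq_nonneg _)]

lemma shear_eq (hB : B.IsRadiationVII0 τ₀) (ht : τ > τ₀) :
    B.shear τ = √(B.Sp τ ^ 2 + (B.R1 τ + B.polarCos τ) / 2) := by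
  have hH := (hB.H_pos τ ht).ne'
  obtain ⟨h01, h02⟩ := shear_eq_zero hB ht
  rw [shear, R1_add_polarCos, σ_eq hB ht, h01, h02, sPlus_eq hB ht, sMinus_eq hB ht,
    sCross_eq hB ht]
  congr 1
  simp [Fin.sum_univ_three]
  field_simp
  ring_nf
  rw [sqrt_three_sq]
  ring

end NormalizedRelations

section Evolution

lemma hasDerivAt_div_H (hB : B.IsRadiationVII0 τ₀) (ht : τ > τ₀) {f : ℝ → ℝ}
    (hf : DifferentiableAt ℝ f τ) :
    HasDerivAt (fun r => f r / B.H r) (B.H τ * deriv f τ / B.H τ ^ 2 +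
      (2 + B.Sp τ ^ 2 + B.polarCos τ) * (f τ / B.H τ)) τ := by
  have hH := (hB.H_pos τ ht).ne'
  have h' : deriv B.H τ = -(2 + B.Sp τ ^ 2 + B.polarCos τ) * B.H τ := by
    apply mul_left_cancel₀ hH
    rw [H_mul_deriv_H hB ht, polarCos, sMinus_eq hB ht, sCross_eq hB ht, nMinus_eq hB ht,
      nCross_eq hB ht, sPlus_eq hB ht]
    simp only [mul_pow, sqrt_three_sq]
    ring
  refine (hf.hasDerivAt.fun_div (hB.H_diff τ ht).hasDerivAt hH).congr_deriv ?_
  rw [h']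
  field_simp
  ring

lemma hasDerivAt_Sp (hB : B.IsRadiationVII0 τ₀) (ht : τ > τ₀) :
    HasDerivAt B.Sp ((B.Sp τ ^ 2 + B.polarCos τ - 1) * B.Sp τ - (B.R1 τ - B.polarCos τ) -
      4 * B.v τ 0 ^ 2 * B.Ω τ / (3 + B.v τ 0 ^ 2)) τ := by
  have hH := (hB.H_pos τ ht).ne'
  have h3 : 3 + B.v τ 0 ^ 2 ≠ 0 := by positivity
  rw [funext B.Sp_eq]
  refine (hasDerivAt_div_H hB ht (differentiableAt_sPlus hB ht)).congr_deriv ?_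
  simp only [H_mul_deriv_sPlus hB ht, boosted_eq hB ht, R1_sub_polarCos, sPlus_eq hB ht,
    nMinus_eq hB ht, nCross_eq hB ht]
  simp only [mul_pow, sqrt_three_sq]
  field_simp
  ring

lemma hasDerivAt_Sm (hB : B.IsRadiationVII0 τ₀) (ht : τ > τ₀) :
    HasDerivAt B.Sm ((B.Sp τ ^ 2 + B.polarCos τ - 1) * B.Sm τ - 2 * B.Np τ * B.Nm τ -
      2 * (B.ω τ 0 / B.H τ) * B.Sx τ) τ := by
  have hH := (hB.H_pos τ ht).ne'
  rw [funext B.Sm_eq]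
  refine ((hasDerivAt_div_H hB ht (differentiableAt_sMinus hB ht)).div_const √3).congr_deriv ?_
  simp only [H_mul_deriv_sMinus hB ht, sMinus_eq hB ht, sCross_eq hB ht, nPlus_eq hB ht,
    nMinus_eq hB ht]
  field_simp
  ring

lemma hasDerivAt_Sx (hB : B.IsRadiationVII0 τ₀) (ht : τ > τ₀) :
    HasDerivAt B.Sx ((B.Sp τ ^ 2 + B.polarCos τ - 1) * B.Sx τ - 2 * B.Np τ * B.Nx τ +
      2 * (B.ω τ 0 / B.H τ) * B.Sm τ) τ := by
  have hH := (hB.H_pos τ ht).ne'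
  rw [funext B.Sx_eq]
  refine ((hasDerivAt_div_H hB ht (differentiableAt_sCross hB ht)).div_const √3).congr_deriv ?_
  simp only [H_mul_deriv_sCross hB ht, sMinus_eq hB ht, sCross_eq hB ht, nPlus_eq hB ht,
    nCross_eq hB ht]
  field_simp
  ring

lemma hasDerivAt_Np (hB : B.IsRadiationVII0 τ₀) (ht : τ > τ₀) :
    HasDerivAt B.Np (((1 + B.Sp τ) ^ 2 + B.polarCos τ) * B.Np τ + 3 * B.polarSin τ) τ := by
  have hH := (hB.H_pos τ ht).ne'
  rw [funext B.Np_eq]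
  refine (hasDerivAt_div_H hB ht (differentiableAt_nPlus hB ht)).congr_deriv ?_
  simp only [H_mul_deriv_nPlus hB ht, sPlus_eq hB ht, sMinus_eq hB ht, sCross_eq hB ht,
    nPlus_eq hB ht, nMinus_eq hB ht, nCross_eq hB ht, polarSin]
  field_simp
  rw [sqrt_three_sq]
  ring

lemma hasDerivAt_Nm (hB : B.IsRadiationVII0 τ₀) (ht : τ > τ₀) :
    HasDerivAt B.Nm ((B.Sp τ ^ 2 + B.polarCos τ + 1 + 2 * B.Sp τ) * B.Nm τ +
      2 * B.Np τ * B.Sm τ - 2 * (B.ω τ 0 / B.H τ) * B.Nx τ) τ := by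
  have hH := (hB.H_pos τ ht).ne'
  rw [funext B.Nm_eq]
  refine ((hasDerivAt_div_H hB ht (differentiableAt_nMinus hB ht)).div_const √3).congr_deriv ?_
  simp only [H_mul_deriv_nMinus hB ht, sPlus_eq hB ht, sMinus_eq hB ht, nPlus_eq hB ht,
    nMinus_eq hB ht, nCross_eq hB ht]
  field_simp
  ring

lemma hasDerivAt_Nx (hB : B.IsRadiationVII0 τ₀) (ht : τ > τ₀) :
    HasDerivAt B.Nx ((B.Sp τ ^ 2 + B.polarCos τ + 1 + 2 * B.Sp τ) * B.Nx τ +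
      2 * B.Np τ * B.Sx τ + 2 * (B.ω τ 0 / B.H τ) * B.Nm τ) τ := by
  have hH := (hB.H_pos τ ht).ne'
  rw [funext B.Nx_eq]
  refine ((hasDerivAt_div_H hB ht (differentiableAt_nCross hB ht)).div_const √3).congr_deriv ?_
  simp only [H_mul_deriv_nCross hB ht, sPlus_eq hB ht, sCross_eq hB ht, nPlus_eq hB ht,
    nMinus_eq hB ht, nCross_eq hB ht]
  field_simp
  ring

lemma hasDerivAt_R1 (hB : B.IsRadiationVII0 τ₀) (ht : τ > τ₀) :
    HasDerivAt B.R1 (2 * (B.Sp τ ^ 2 + B.polarCos τ + B.Sp τ) * B.R1 τ -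
      2 * (1 + B.Sp τ) * B.polarCos τ) τ := by
  refine (((((hasDerivAt_Sm hB ht).fun_pow 2).fun_add ((hasDerivAt_Sx hB ht).fun_pow 2)).fun_add
    ((hasDerivAt_Nm hB ht).fun_pow 2)).fun_add ((hasDerivAt_Nx hB ht).fun_pow 2)).congr_deriv ?_
  rw [R1, polarCos]
  ring

lemma hasDerivAt_polarCos (hB : B.IsRadiationVII0 τ₀) (ht : τ > τ₀) :
    HasDerivAt B.polarCos (2 * (B.Sp τ ^ 2 + B.polarCos τ + B.Sp τ) * B.polarCos τ -
      2 * (1 + B.Sp τ) * B.R1 τ - 4 * B.Np τ * B.polarSin τ) τ := by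
  refine (((((hasDerivAt_Sm hB ht).fun_pow 2).fun_add ((hasDerivAt_Sx hB ht).fun_pow 2)).fun_sub
    ((hasDerivAt_Nm hB ht).fun_pow 2)).fun_sub ((hasDerivAt_Nx hB ht).fun_pow 2)).congr_deriv ?_
  rw [R1, polarCos, polarSin]
  ring

lemma hasDerivAt_polarSin (hB : B.IsRadiationVII0 τ₀) (ht : τ > τ₀) :
    HasDerivAt B.polarSin (2 * (B.Sp τ ^ 2 + B.polarCos τ + B.Sp τ) * B.polarSin τ +
      4 * B.Np τ * B.polarCos τ) τ := by
  refine ((((hasDerivAt_Sm hB ht).fun_mul (hasDerivAt_Nm hB ht)).fun_add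
    ((hasDerivAt_Sx hB ht).fun_mul (hasDerivAt_Nx hB ht))).const_mul 2).congr_deriv ?_
  rw [polarCos, polarSin]
  ring

lemma hasDerivAt_wedge (hB : B.IsRadiationVII0 τ₀) (ht : τ > τ₀) :
    HasDerivAt B.wedge (2 * (B.Sp τ ^ 2 + B.polarCos τ + B.Sp τ) * B.wedge τ) τ := by
  refine (((hasDerivAt_Sx hB ht).fun_mul (hasDerivAt_Nm hB ht)).fun_sub
    ((hasDerivAt_Sm hB ht).fun_mul (hasDerivAt_Nx hB ht))).congr_deriv ?_
  rw [polarCos, wedge]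
  ring

/-- Energy-momentum conservation along `e₁`, read off from the Codazzi constraint by
differentiating it. -/
lemma hasDerivAt_tilt (hB : B.IsRadiationVII0 τ₀) (ht : τ > τ₀) (hΩ : 0 < B.Ω τ) :
    HasDerivAt (fun r => B.v r 0)
      (6 * B.Sp τ * B.v τ 0 * (1 - B.v τ 0 ^ 2) / (3 - B.v τ 0 ^ 2)) τ := by
  have hv := (hB.v_diff τ ht 0).hasDerivAt
  refine hv.congr_deriv ?_
  have h3 : 0 < 3 + B.v τ 0 ^ 2 := by positivity
  have h3' : 0 < 3 - B.v τ 0 ^ 2 := by linarith [tilt_sq_lt_one hB ht]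
  have hcodazzi : (fun r => B.wedge r * (3 + B.v r 0 ^ 2)) =ᶠ[𝓝 τ]
      fun r => 2 * B.v r 0 * (1 - B.Sp r ^ 2 - B.R1 r) := by
    filter_upwards [eventually_gt_nhds ht] with r hr
    rw [wedge_eq hB hr, Ω_eq hB hr, div_mul_cancel₀ _ (by positivity)]
  have hleft := (hasDerivAt_wedge hB ht).fun_mul ((hv.fun_pow 2).const_add 3)
  have hright := (hv.const_mul 2).fun_mul
    ((((hasDerivAt_Sp hB ht).fun_pow 2).const_sub 1).fun_sub (hasDerivAt_R1 hB ht))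
  have heq := hleft.unique (hright.congr_of_eventuallyEq hcodazzi)
  rw [wedge_eq hB ht] at heq
  rw [Ω_eq hB ht] at heq hΩ
  rw [eq_div_iff h3'.ne']
  apply mul_left_cancel₀ hΩ.ne'
  simp only [Nat.cast_ofNat, Nat.add_one_sub_one, pow_one] at heq
  field_simp at heq
  linear_combination -heq

end Evolution

end BianchiModel

/-- `F` is the invariant flow of the model `B` up to the orientation of the frame, which reverses
the signs of `N₊` and of `𝓡₂ sin 2ψ` and is not fixed by the model. -/
structure InvariantFlow.Represents {τ₀ : ℝ} (F : InvariantFlow τ₀) (B : BianchiModel) : Prop where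
  x_eq : F.x = B.Sp
  R_eq : F.R = B.R1
  A_eq : F.A = B.polarCos
  v_eq : F.v = fun τ => B.v τ 0
  abs_C : ∀ τ, |F.C τ| = |B.polarSin τ|
  abs_N : ∀ τ, |F.N τ| = |B.Np τ|

namespace BianchiModel

variable {B : BianchiModel} {τ₀ τ : ℝ}

section Flow

lemma Np_ne_zero (hB : B.IsRadiationVII0 τ₀) (ht : τ > τ₀) : B.Np τ ≠ 0 := by
  rw [← sq_pos_iff]
  refine lt_of_le_of_lt ?_ (Np_sq_gt hB ht)
  rw [R1_sub_polarCos]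
  positivity

lemma exists_sign_mul_Np_pos (hB : B.IsRadiationVII0 τ₀) :
    ∃ ε : ℝ, |ε| = 1 ∧ ∀ τ > τ₀, 0 < ε * B.Np τ := by
  have hc : ContinuousOn B.Np (Set.Ioi τ₀) := fun τ ht =>
    (hasDerivAt_Np hB ht).continuousAt.continuousWithinAt
  by_cases h : ∃ a > τ₀, 0 < B.Np a
  · obtain ⟨a, ha, hpos⟩ := h
    refine ⟨1, abs_one, fun b hb => ?_⟩
    by_contra! hneg
    rw [one_mul] at hneg
    obtain ⟨c, hc, h0⟩ := isPreconnected_Ioi.intermediate_value hb ha hc ⟨hneg, hpos.le⟩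
    exact Np_ne_zero hB hc h0
  · push Not at h
    refine ⟨-1, by simp, fun b hb => ?_⟩
    linarith [(h b hb).lt_of_ne (Np_ne_zero hB hb)]

lemma exists_represents (hB : B.IsRadiationVII0 τ₀) (hΩ : ∀ τ > τ₀, 0 < B.Ω τ)
    (hv : ∀ τ > τ₀, 0 < B.v τ 0) : ∃ F : InvariantFlow τ₀, F.Represents B := by
  obtain ⟨ε, hε, hN⟩ := exists_sign_mul_Np_pos hB
  have hε2 : ε ^ 2 = 1 := by rw [← sq_abs, hε, one_pow]
  refine ⟨{
    x := B.Sp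
    R := B.R1
    A := B.polarCos
    C := fun τ => ε * B.polarSin τ
    X := B.wedge
    N := fun τ => ε * B.Np τ
    v := fun τ => B.v τ 0
    evol_x t ht := by rw [← Ω_eq hB ht]; exact hasDerivAt_Sp hB ht
    evol_R t ht := hasDerivAt_R1 hB ht
    evol_A t ht := (hasDerivAt_polarCos hB ht).congr_deriv
      (by linear_combination 4 * B.Np t * B.polarSin t * hε2)
    evol_C t ht := ((hasDerivAt_polarSin hB ht).const_mul ε).congr_deriv (by ring)
    evol_X t ht := hasDerivAt_wedge hB ht
    evol_N t ht := ((hasDerivAt_Np hB ht).const_mul ε).congr_deriv (by ring)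
    evol_v t ht := hasDerivAt_tilt hB ht (hΩ t ht)
    v_pos := hv
    v_lt_one t ht := lt_of_pow_lt_pow_left₀ 2 zero_le_one (by simpa using tilt_sq_lt_one hB ht)
    density_pos t ht := Ω_eq hB ht ▸ hΩ t ht
    X_eq t ht := by rw [← Ω_eq hB ht]; exact wedge_eq hB ht
    R_nonneg t _ := by rw [R1]; positivity
    R_sq t _ := by rw [R1_sq, mul_pow, hε2, one_mul]
    N_pos := hN
    det_pos t ht := by rw [mul_pow, hε2, one_mul]; exact sub_pos.2 (Np_sq_gt hB ht) },
    rfl, rfl, rfl, rfl, fun τ => ?_, fun τ => ?_⟩ <;> simp [abs_mul, hε]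

end Flow

section WeylSymmetries

lemma sum_sum_of_symm (f : Fin 4 → Fin 4 → ℝ) (h0 : ∀ a, f a a = 0)
    (hs : ∀ a b, f b a = f a b) :
    ∑ a, ∑ b, f a b = 2 * ∑ α : Fin 3, (f 0 α.succ + f (α + 1).succ (α + 2).succ) := by
  simp [Fin.sum_univ_succ, h0, hs 0 1, hs 0 2, hs 0 3, hs 1 2, hs 1 3, hs 2 3]
  ring

variable (B τ)

lemma riem_swap_right (a b c d : Fin 4) : B.riem τ a b d c = -B.riem τ a b c d := by
  simp only [riem, B.comm_swap τ _ c d, neg_add, ← Finset.sum_neg_distrib]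
  congr 1
  · ring
  · exact Finset.sum_congr rfl fun f _ => by ring

lemma conn_eq_neg_conn_swap (r : ℝ) (a b c : Fin 4) :
    B.conn r b c a = -(sgn a * sgn b) * B.conn r a c b := by
  linear_combination sgn b * B.conn_swap r a c b - B.conn r b c a * sgn_mul_self b

lemma frameDeriv_conn_swap (a b c d : Fin 4) :
    B.frameDeriv c (fun r => B.conn r b d a) τ =
      -(sgn a * sgn b) * B.frameDeriv c (fun r => B.conn r a d b) τ := by
  simp only [conn_eq_neg_conn_swap B _ a b, frameDeriv]
  split_ifs
  · rw [deriv_const_mul_field]; ring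
  · ring

lemma riem_swap_left (a b c d : Fin 4) :
    B.riem τ b a c d = -(sgn a * sgn b) * B.riem τ a b c d := by
  have hprod (c d f : Fin 4) : B.conn τ f d a * B.conn τ b c f =
      sgn a * sgn b * (B.conn τ f c b * B.conn τ a d f) := by
    rw [conn_eq_neg_conn_swap B τ f b c, conn_eq_neg_conn_swap B τ a f d]
    linear_combination
      sgn a * sgn b * B.conn τ f c b * B.conn τ a d f * sgn_mul_self f
  simp only [riem, frameDeriv_conn_swap B τ a b, mul_add, mul_sub, Finset.mul_sum]
  congr 1
  refine Finset.sum_congr rfl fun f _ => ?_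
  rw [hprod, hprod, conn_eq_neg_conn_swap B τ a b f]
  ring

lemma weyl_swap_right (a b c d : Fin 4) : B.weyl τ a b d c = -B.weyl τ a b c d := by
  simp only [weyl, B.riem_swap_right τ a b c d]
  ring

lemma weyl_swap_left (a b c d : Fin 4) : B.weyl τ b a c d = -B.weyl τ a b c d := by
  simp only [weyl, B.riem_swap_left τ a b c d]
  linear_combination -sgn a * B.riem τ a b c d * sgn_mul_self b

lemma weylDual_swap_right (a b c d : Fin 4) : B.weylDual τ a b d c = -B.weylDual τ a b c d := by
  simp only [weylDual, B.weyl_swap_right τ _ _ c d, mul_neg, Finset.sum_neg_distrib, neg_div]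

lemma weylDual_swap_left (a b c d : Fin 4) : B.weylDual τ b a c d = -B.weylDual τ a b c d := by
  have heps (e f : Fin 4) : eps4 b a e f = -eps4 a b e f := by unfold eps4; ring
  simp only [weylDual, heps, neg_mul, Finset.sum_neg_distrib, neg_div]

lemma weylDual_eq_sum (a b c d : Fin 4) :
    B.weylDual τ a b c d = ∑ α : Fin 3, (eps4 a b 0 α.succ * B.weyl τ 0 α.succ c d -
      eps4 a b (α + 1).succ (α + 2).succ * B.weyl τ (α + 1).succ (α + 2).succ c d) := by
  have hswap (e f : Fin 4) : eps4 a b f e = -eps4 a b e f := by unfold eps4; ring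
  rw [weylDual, sum_sum_of_symm _ (fun e => by simp [eps4])
    (fun e f => by rw [hswap e f, B.weyl_swap_left τ e f]; ring),
    mul_div_cancel_left₀ _ two_ne_zero]
  exact Finset.sum_congr rfl fun α _ => by simp only [sgn_zero, sgn_succ]; ring

lemma weylDual_zero_succ (α : Fin 3) (c d : Fin 4) :
    B.weylDual τ 0 α.succ c d = -B.weyl τ (α + 1).succ (α + 2).succ c d := by
  rw [weylDual_eq_sum, Fin.sum_univ_three]
  fin_cases α <;> simp [eps4] <;> ring

lemma weylDual_succ_succ (α : Fin 3) (c d : Fin 4) :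
    B.weylDual τ (α + 1).succ (α + 2).succ c d = B.weyl τ 0 α.succ c d := by
  rw [weylDual_eq_sum, Fin.sum_univ_three]
  fin_cases α <;> simp [eps4] <;> ring

lemma sum_contract (T U : Fin 4 → Fin 4 → Fin 4 → Fin 4 → ℝ)
    (hT : ∀ a b c d, T b a c d = -T a b c d) (hT' : ∀ a b c d, T a b d c = -T a b c d)
    (hU : ∀ a b c d, U b a c d = -U a b c d) (hU' : ∀ a b c d, U a b d c = -U a b c d) :
    ∑ a, ∑ b, ∑ c, ∑ d, sgn a * sgn b * sgn c * sgn d * T a b c d * U a b c d =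
      4 * ∑ α : Fin 3, ∑ β : Fin 3, (T 0 α.succ 0 β.succ * U 0 α.succ 0 β.succ -
        T 0 α.succ (β + 1).succ (β + 2).succ * U 0 α.succ (β + 1).succ (β + 2).succ -
        T (α + 1).succ (α + 2).succ 0 β.succ * U (α + 1).succ (α + 2).succ 0 β.succ +
        T (α + 1).succ (α + 2).succ (β + 1).succ (β + 2).succ *
          U (α + 1).succ (α + 2).succ (β + 1).succ (β + 2).succ) := by
  have h0 (a c d : Fin 4) : T a a c d = 0 := self_eq_neg.1 (hT a a c d)
  have h0' (a b c : Fin 4) : T a b c c = 0 := self_eq_neg.1 (hT' a b c c)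
  have hinner (a b : Fin 4) := sum_sum_of_symm
    (fun c d => sgn a * sgn b * sgn c * sgn d * T a b c d * U a b c d)
    (fun c => by simp only [h0']; ring) (fun c d => by simp only [hT' a b c d, hU' a b c d]; ring)
  simp only [hinner]
  rw [sum_sum_of_symm _ (fun a => by simp [h0]) (fun a b => by
    simp only [hT a b, hU a b, mul_neg, neg_neg, neg_mul, mul_comm (sgn a)])]
  simp only [sgn_zero, sgn_succ, ← mul_add, ← Finset.sum_add_distrib, Finset.mul_sum]
  exact Finset.sum_congr rfl fun α _ => Finset.sum_congr rfl fun β _ => by ring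

end WeylSymmetries

section WeylVariables

/-- The trace-free symmetric matrices with the block structure of the shear. The entries are scaled
as in `Σ_{αβ}`, so that the contraction of two such matrices is six times the inner product of
their parameters. -/
noncomputable def traceFree (p m c : ℝ) : Matrix (Fin 3) (Fin 3) ℝ :=
  !![-2 * p, 0, 0; 0, p + √3 * m, √3 * c; 0, √3 * c, p - √3 * m]

lemma sum_traceFree_mul_traceFree (p m c p' m' c' : ℝ) :
    ∑ α, ∑ β, traceFree p m c α β * traceFree p' m' c' α β = 6 * (p * p' + m * m' + c * c') := by
  simp [traceFree, Fin.sum_univ_three]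
  linear_combination 2 * (m * m' + c * c') * sqrt_three_sq

variable (B τ)

/-- `-E₁₁ / (2H²)`, where `E` is the electric part of the Weyl tensor. -/
noncomputable def electricPlus : ℝ :=
  B.Sp τ + B.Sp τ ^ 2 + (B.R1 τ - 3 * B.polarCos τ) / 2 + B.v τ 0 * B.wedge τ

/-- `(E₂₂ - E₃₃) / (2√3 H²)`, where `E` is the electric part of the Weyl tensor. -/
noncomputable def electricMinus : ℝ := (1 - 2 * B.Sp τ) * B.Sm τ + 2 * B.Np τ * B.Nm τ

/-- `E₂₃ / (√3 H²)`, where `E` is the electric part of the Weyl tensor. -/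
noncomputable def electricCross : ℝ := (1 - 2 * B.Sp τ) * B.Sx τ + 2 * B.Np τ * B.Nx τ

/-- The magnetic analogue of `electricPlus`. -/
noncomputable def magneticPlus : ℝ := 3 / 2 * B.polarSin τ

/-- The magnetic analogue of `electricMinus`. -/
noncomputable def magneticMinus : ℝ := 3 * B.Sp τ * B.Nm τ + 2 * B.Np τ * B.Sm τ

/-- The magnetic analogue of `electricCross`. -/
noncomputable def magneticCross : ℝ := 3 * B.Sp τ * B.Nx τ + 2 * B.Np τ * B.Sx τ

/-- The electric part of the Weyl tensor, normalized by `H²`. -/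
noncomputable def electric : Matrix (Fin 3) (Fin 3) ℝ :=
  traceFree (B.electricPlus τ) (B.electricMinus τ) (B.electricCross τ)

/-- The magnetic part of the Weyl tensor, normalized by `H²`. -/
noncomputable def magnetic : Matrix (Fin 3) (Fin 3) ℝ :=
  traceFree (B.magneticPlus τ) (B.magneticMinus τ) (B.magneticCross τ)

end WeylVariables

variable {B : BianchiModel} {τ₀ τ : ℝ}

section WeylComponents

lemma H_sq_mul_electricPlus (hB : B.IsRadiationVII0 τ₀) (ht : τ > τ₀) :
    B.H τ ^ 2 * B.electricPlus τ = B.H τ * B.sPlus τ + B.sPlus τ ^ 2 +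
      2 / 3 * (B.nMinus τ ^ 2 + B.nCross τ ^ 2) - (B.sMinus τ ^ 2 + B.sCross τ ^ 2) / 3 +
      2 / 9 * B.boosted τ * B.v τ 0 ^ 2 := by
  have hflux : B.H τ ^ 2 * (B.v τ 0 * B.wedge τ) = 2 / 9 * B.boosted τ * B.v τ 0 ^ 2 := by
    rw [wedge_eq hB ht, boosted_eq hB ht]; ring
  rw [electricPlus, sPlus_eq hB ht, sMinus_eq hB ht, sCross_eq hB ht, nMinus_eq hB ht,
    nCross_eq hB ht]
  linear_combination hflux + B.H τ ^ 2 * (2 * B.R1_sub_polarCos τ - B.R1_add_polarCos τ) / 2 -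
    B.H τ ^ 2 * (2 * (B.Nm τ ^ 2 + B.Nx τ ^ 2) - (B.Sm τ ^ 2 + B.Sx τ ^ 2)) / 3 * sqrt_three_sq

lemma H_sq_mul_electricMinus (hB : B.IsRadiationVII0 τ₀) (ht : τ > τ₀) :
    B.H τ ^ 2 * (√3 * B.electricMinus τ) =
      (B.H τ - 2 * B.sPlus τ) * B.sMinus τ + 2 * B.nPlus τ * B.nMinus τ := by
  rw [electricMinus, sPlus_eq hB ht, sMinus_eq hB ht, nPlus_eq hB ht, nMinus_eq hB ht]
  ring

lemma H_sq_mul_electricCross (hB : B.IsRadiationVII0 τ₀) (ht : τ > τ₀) :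
    B.H τ ^ 2 * (√3 * B.electricCross τ) =
      (B.H τ - 2 * B.sPlus τ) * B.sCross τ + 2 * B.nPlus τ * B.nCross τ := by
  rw [electricCross, sPlus_eq hB ht, sCross_eq hB ht, nPlus_eq hB ht, nCross_eq hB ht]
  ring

lemma H_sq_mul_magneticPlus (hB : B.IsRadiationVII0 τ₀) (ht : τ > τ₀) :
    B.H τ ^ 2 * B.magneticPlus τ = B.sMinus τ * B.nMinus τ + B.sCross τ * B.nCross τ := by
  rw [magneticPlus, polarSin, sMinus_eq hB ht, sCross_eq hB ht, nMinus_eq hB ht, nCross_eq hB ht]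
  linear_combination
    -B.H τ ^ 2 * (B.Sm τ * B.Nm τ + B.Sx τ * B.Nx τ) * sqrt_three_sq

lemma H_sq_mul_magneticMinus (hB : B.IsRadiationVII0 τ₀) (ht : τ > τ₀) :
    B.H τ ^ 2 * (√3 * B.magneticMinus τ) =
      3 * B.sPlus τ * B.nMinus τ + 2 * B.nPlus τ * B.sMinus τ := by
  rw [magneticMinus, sPlus_eq hB ht, sMinus_eq hB ht, nPlus_eq hB ht, nMinus_eq hB ht]
  ring

lemma H_sq_mul_magneticCross (hB : B.IsRadiationVII0 τ₀) (ht : τ > τ₀) :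
    B.H τ ^ 2 * (√3 * B.magneticCross τ) =
      3 * B.sPlus τ * B.nCross τ + 2 * B.nPlus τ * B.sCross τ := by
  rw [magneticCross, sPlus_eq hB ht, sCross_eq hB ht, nPlus_eq hB ht, nCross_eq hB ht]
  ring

lemma weyl_eq (hB : B.IsRadiationVII0 τ₀) (ht : τ > τ₀) (a b c d : Fin 4) :
    B.weyl τ a b c d = sgn a * riemTable (B.conn τ) (B.connDeriv τ) a b c d -
      (g a c * B.stress τ b d - g a d * B.stress τ b c +
        g b d * B.stress τ a c - g b c * B.stress τ a d) / 2 := by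
  simp only [weyl, riem_eq hB ht, ricci_eq_stress hB ht, scalar_eq_zero hB ht]
  ring

lemma weyl_zero_succ_zero_succ (hB : B.IsRadiationVII0 τ₀) (ht : τ > τ₀) (α β : Fin 3) :
    B.weyl τ 0 α.succ 0 β.succ = B.H τ ^ 2 * B.electric τ α β := by
  rw [weyl_eq hB ht, conn_eq_block hB ht, connDeriv_eq_block hB ht]
  simp only [H_mul_deriv_H hB ht, H_mul_deriv_sPlus hB ht, H_mul_deriv_sMinus hB ht,
    H_mul_deriv_sCross hB ht, stress_eq hB ht]
  have hp := H_sq_mul_electricPlus hB ht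
  have hm := H_sq_mul_electricMinus hB ht
  have hc := H_sq_mul_electricCross hB ht
  have hg := gauss_constraint hB ht
  fin_cases α <;> fin_cases β <;>
    simp [riemTable, connTable, Fin.sum_univ_four, g, sgn_of_ne_zero, electric, traceFree] <;>
    linarith

lemma weyl_zero_succ_succ_succ (hB : B.IsRadiationVII0 τ₀) (ht : τ > τ₀) (α β : Fin 3) :
    B.weyl τ 0 α.succ (β + 1).succ (β + 2).succ = B.H τ ^ 2 * B.magnetic τ α β := by
  rw [weyl_eq hB ht, conn_eq_block hB ht, connDeriv_eq_block hB ht]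
  simp only [stress_eq hB ht]
  have hp := H_sq_mul_magneticPlus hB ht
  have hm := H_sq_mul_magneticMinus hB ht
  have hc := H_sq_mul_magneticCross hB ht
  have hflux := einstein_zero_one hB ht
  fin_cases α <;> fin_cases β <;>
    simp [riemTable, connTable, Fin.sum_univ_four, g, sgn_of_ne_zero, magnetic, traceFree] <;>
    linarith

lemma weyl_succ_succ_zero_succ (hB : B.IsRadiationVII0 τ₀) (ht : τ > τ₀) (α β : Fin 3) :
    B.weyl τ (α + 1).succ (α + 2).succ 0 β.succ = B.H τ ^ 2 * B.magnetic τ α β := by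
  rw [weyl_eq hB ht, conn_eq_block hB ht, connDeriv_eq_block hB ht]
  simp only [H_mul_deriv_nPlus hB ht, H_mul_deriv_nMinus hB ht, H_mul_deriv_nCross hB ht,
    stress_eq hB ht]
  have hp := H_sq_mul_magneticPlus hB ht
  have hm := H_sq_mul_magneticMinus hB ht
  have hc := H_sq_mul_magneticCross hB ht
  have hflux := einstein_zero_one hB ht
  fin_cases α <;> fin_cases β <;>
    simp [riemTable, connTable, Fin.sum_univ_four, g, sgn_of_ne_zero, magnetic, traceFree] <;>
    linarith

lemma weyl_succ_succ_succ_succ (hB : B.IsRadiationVII0 τ₀) (ht : τ > τ₀) (α β : Fin 3) :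
    B.weyl τ (α + 1).succ (α + 2).succ (β + 1).succ (β + 2).succ =
      -(B.H τ ^ 2 * B.electric τ α β) := by
  rw [weyl_eq hB ht, conn_eq_block hB ht, connDeriv_eq_block hB ht]
  simp only [stress_eq hB ht]
  have hp := H_sq_mul_electricPlus hB ht
  have hm := H_sq_mul_electricMinus hB ht
  have hc := H_sq_mul_electricCross hB ht
  have hg := gauss_constraint hB ht
  fin_cases α <;> fin_cases β <;>
    simp [riemTable, connTable, Fin.sum_univ_four, g, sgn_of_ne_zero, electric, traceFree] <;>
    linarith

lemma W1_eq (hB : B.IsRadiationVII0 τ₀) (ht : τ > τ₀) :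
    B.W1 τ = B.electricPlus τ ^ 2 + B.electricMinus τ ^ 2 + B.electricCross τ ^ 2 -
      (B.magneticPlus τ ^ 2 + B.magneticMinus τ ^ 2 + B.magneticCross τ ^ 2) := by
  have hH := (hB.H_pos τ ht).ne'
  have hsum : ∑ a, ∑ b, ∑ c, ∑ d, sgn a * sgn b * sgn c * sgn d * B.weyl τ a b c d *
      B.weyl τ a b c d = 8 * B.H τ ^ 4 * (∑ α, ∑ β, B.electric τ α β * B.electric τ α β -
        ∑ α, ∑ β, B.magnetic τ α β * B.magnetic τ α β) := by
    rw [sum_contract _ _ (B.weyl_swap_left τ) (B.weyl_swap_right τ) (B.weyl_swap_left τ)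
      (B.weyl_swap_right τ)]
    simp only [weyl_zero_succ_zero_succ hB ht, weyl_zero_succ_succ_succ hB ht,
      weyl_succ_succ_zero_succ hB ht, weyl_succ_succ_succ_succ hB ht, ← Finset.sum_sub_distrib,
      Finset.mul_sum]
    exact Finset.sum_congr rfl fun α _ => Finset.sum_congr rfl fun β _ => by ring
  rw [W1, hsum, electric, magnetic, sum_traceFree_mul_traceFree, sum_traceFree_mul_traceFree]
  field_simp
  ring

lemma W2_eq (hB : B.IsRadiationVII0 τ₀) (ht : τ > τ₀) :
    B.W2 τ = -2 * (B.electricPlus τ * B.magneticPlus τ + B.electricMinus τ * B.magneticMinus τ +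
      B.electricCross τ * B.magneticCross τ) := by
  have hH := (hB.H_pos τ ht).ne'
  have hsum : ∑ a, ∑ b, ∑ c, ∑ d, sgn a * sgn b * sgn c * sgn d * B.weyl τ a b c d *
      B.weylDual τ a b c d =
      -16 * B.H τ ^ 4 * ∑ α, ∑ β, B.electric τ α β * B.magnetic τ α β := by
    rw [sum_contract _ _ (B.weyl_swap_left τ) (B.weyl_swap_right τ) (B.weylDual_swap_left τ)
      (B.weylDual_swap_right τ)]
    simp only [weylDual_zero_succ, weylDual_succ_succ, weyl_zero_succ_zero_succ hB ht,
      weyl_zero_succ_succ_succ hB ht, weyl_succ_succ_zero_succ hB ht,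
      weyl_succ_succ_succ_succ hB ht, Finset.mul_sum]
    exact Finset.sum_congr rfl fun α _ => Finset.sum_congr rfl fun β _ => by ring
  rw [W2, hsum, electric, magnetic, sum_traceFree_mul_traceFree]
  field_simp
  ring

lemma W1_eq_expansion (hB : B.IsRadiationVII0 τ₀) (ht : τ > τ₀) :
    B.W1 τ = -4 * B.Np τ ^ 2 * B.polarCos τ + 2 * (1 - 5 * B.Sp τ) * B.Np τ * B.polarSin τ +
      (B.electricPlus τ ^ 2 - 9 / 4 * B.polarSin τ ^ 2 +
        (1 - 2 * B.Sp τ) ^ 2 / 2 * (B.R1 τ + B.polarCos τ) -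
        9 / 2 * B.Sp τ ^ 2 * (B.R1 τ - B.polarCos τ)) := by
  rw [W1_eq hB ht, electricMinus, electricCross, magneticPlus, magneticMinus, magneticCross,
    R1, polarCos, polarSin]
  ring

lemma W2_eq_expansion (hB : B.IsRadiationVII0 τ₀) (ht : τ > τ₀) :
    B.W2 τ = -4 * B.Np τ ^ 2 * B.polarSin τ -
      B.Np τ * (2 * (1 - 2 * B.Sp τ) * (B.R1 τ + B.polarCos τ) +
        6 * B.Sp τ * (B.R1 τ - B.polarCos τ)) -
      3 * (B.electricPlus τ + B.Sp τ * (1 - 2 * B.Sp τ)) * B.polarSin τ := by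
  rw [W2_eq hB ht, electricMinus, electricCross, magneticPlus, magneticMinus, magneticCross,
    R1, polarCos, polarSin]
  ring

end WeylComponents

end BianchiModel

section RelativeError

variable {ι : Type*} {l : Filter ι}

lemma exists_relative_error {W K c m : ι → ℝ} (hK : ∀ᶠ t in l, K t ≠ 0)
    (h : (fun t => W t + K t * c t) =O[l] fun t => K t * m t) :
    ∃ ε : ι → ℝ, ε =O[l] m ∧ ∀ᶠ t in l, W t = -K t * (c t + ε t) := by
  refine ⟨fun t => (K t)⁻¹ * -(W t + K t * c t), ?_, hK.mono fun t ht => by field_simp; ring⟩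
  refine ((isBigO_refl (fun t => (K t)⁻¹) l).mul h.neg_left).trans_eventuallyEq ?_
  exact hK.mono fun t ht => inv_mul_cancel_left₀ ht (m t)

lemma tendsto_sqrt_sq_add_sq_atTop {W₁ W₂ K θ ε₁ ε₂ : ι → ℝ} (hK : Tendsto K l atTop)
    (hε₁ : Tendsto ε₁ l (𝓝 0)) (hε₂ : Tendsto ε₂ l (𝓝 0))
    (hW₁ : ∀ᶠ t in l, W₁ t = -K t * (Real.cos (θ t) + ε₁ t))
    (hW₂ : ∀ᶠ t in l, W₂ t = -K t * (Real.sin (θ t) + ε₂ t)) :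
    Tendsto (fun t => √(W₁ t ^ 2 + W₂ t ^ 2)) l atTop := by
  have hcos := bdd_le_mul_tendsto_zero' 1 (.of_forall fun t => Real.abs_cos_le_one (θ t)) hε₁
  have hsin := bdd_le_mul_tendsto_zero' 1 (.of_forall fun t => Real.abs_sin_le_one (θ t)) hε₂
  have hone : Tendsto (fun t => √(1 + 2 * (Real.cos (θ t) * ε₁ t + Real.sin (θ t) * ε₂ t) +
      (ε₁ t ^ 2 + ε₂ t ^ 2))) l (𝓝 1) := by
    simpa using ((((hcos.add hsin).const_mul 2).const_add 1).add
      ((hε₁.pow 2).add (hε₂.pow 2))).sqrt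
  refine (hK.atTop_mul_pos one_pos hone).congr' ?_
  filter_upwards [hW₁, hW₂, hK.eventually_ge_atTop 0] with t h₁ h₂ hKt
  rw [h₁, h₂, ← Real.sqrt_sq hKt, ← Real.sqrt_mul (sq_nonneg _), Real.sqrt_sq hKt]
  congr 1
  linear_combination -K t ^ 2 * Real.cos_sq_add_sin_sq (θ t)

end RelativeError

namespace BianchiModel

variable {B : BianchiModel} {τ₀ τ : ℝ}

lemma R1_nonneg (B : BianchiModel) (τ : ℝ) : 0 ≤ B.R1 τ := by rw [R1]; positivity

lemma isBigO_polarCos_R1 (l : Filter ℝ) : B.polarCos =O[l] B.R1 :=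
  .of_norm_le fun τ => abs_le_of_sq_le_sq (by
    nlinarith [B.R1_sq τ, sq_nonneg (B.polarSin τ), sq_nonneg (B.wedge τ)]) (B.R1_nonneg τ)

lemma isBigO_polarSin_R1 (l : Filter ℝ) : B.polarSin =O[l] B.R1 :=
  .of_norm_le fun τ => abs_le_of_sq_le_sq (by
    nlinarith [B.R1_sq τ, sq_nonneg (B.polarCos τ), sq_nonneg (B.wedge τ)]) (B.R1_nonneg τ)

lemma isBigO_wedge_R1 (l : Filter ℝ) : B.wedge =O[l] B.R1 :=
  .of_norm_le fun τ => abs_le_of_sq_le_sq (by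
    nlinarith [B.R1_sq τ, sq_nonneg (B.polarCos τ), sq_nonneg (B.polarSin τ)]) (B.R1_nonneg τ)

lemma div_M_sq (x : ℝ) : x / B.M τ ^ 2 = x * B.Np τ ^ 2 := by
  rw [M, one_div, inv_pow, div_inv_eq_mul]

lemma IsPolar.sq_add_sq {R2 ψ : ℝ → ℝ} (h : B.IsPolar R2 ψ τ) :
    B.polarCos τ ^ 2 + B.polarSin τ ^ 2 = R2 τ ^ 2 := by
  rw [polarCos, polarSin, ← h.1, ← h.2]
  linear_combination R2 τ ^ 2 * Real.cos_sq_add_sin_sq (2 * ψ τ)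

end BianchiModel

namespace InvariantFlow.Represents

variable {τ₀ : ℝ} {F : InvariantFlow τ₀} {B : BianchiModel} {R2 ψ : ℝ → ℝ}

lemma tendsto_Sp (hF : F.Represents B) : Tendsto B.Sp atTop (𝓝 0) := hF.x_eq ▸ F.tendsto_x

lemma tendsto_R1 (hF : F.Represents B) : Tendsto B.R1 atTop (𝓝 0) := hF.R_eq ▸ F.tendsto_R

lemma tendsto_polarCos (hF : F.Represents B) : Tendsto B.polarCos atTop (𝓝 0) :=
  hF.A_eq ▸ F.tendsto_A

lemma tendsto_polarSin (hF : F.Represents B) : Tendsto B.polarSin atTop (𝓝 0) :=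
  (BianchiModel.isBigO_polarSin_R1 atTop).trans_tendsto hF.tendsto_R1

lemma tendsto_Ω (hF : F.Represents B) (hB : B.IsRadiationVII0 τ₀) :
    Tendsto B.Ω atTop (𝓝 1) := by
  have h : Tendsto (fun τ => 1 - B.Sp τ ^ 2 - B.R1 τ) atTop (𝓝 1) := by
    simpa using ((hF.tendsto_Sp.pow 2).const_sub 1).sub hF.tendsto_R1
  exact h.congr' ((eventually_gt_atTop τ₀).mono fun τ ht => (BianchiModel.Ω_eq hB ht).symm)

lemma tendsto_v_zero (hF : F.Represents B) : Tendsto (fun τ => B.v τ 0) atTop (𝓝 0) :=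
  hF.v_eq ▸ F.tendsto_v

lemma tendsto_v (hF : F.Represents B) (hB : B.IsRadiationVII0 τ₀) (α : Fin 3) :
    Tendsto (fun τ => B.v τ α) atTop (𝓝 0) := by
  have h := (eventually_gt_atTop τ₀).mono fun τ ht => BianchiModel.tilt_eq_zero hB ht
  fin_cases α
  · exact hF.tendsto_v_zero
  · exact tendsto_nhds_of_eventually_eq (h.mono fun _ hτ => hτ.1)
  · exact tendsto_nhds_of_eventually_eq (h.mono fun _ hτ => hτ.2)

lemma tendsto_shear (hF : F.Represents B) (hB : B.IsRadiationVII0 τ₀) :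
    Tendsto B.shear atTop (𝓝 0) := by
  have h : Tendsto (fun τ => √(B.Sp τ ^ 2 + (B.R1 τ + B.polarCos τ) / 2)) atTop (𝓝 0) := by
    simpa using ((hF.tendsto_Sp.pow 2).add
      ((hF.tendsto_R1.add hF.tendsto_polarCos).div_const 2)).sqrt
  exact h.congr' ((eventually_gt_atTop τ₀).mono fun τ ht => (BianchiModel.shear_eq hB ht).symm)

lemma tendsto_M (hF : F.Represents B) : Tendsto B.M atTop (𝓝 0) := by
  have habs (τ : ℝ) : |F.M τ| = |B.M τ| := by
    rw [InvariantFlow.M, BianchiModel.M, abs_div, abs_div, hF.abs_N]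
  rw [tendsto_zero_iff_abs_tendsto_zero]
  simpa [Function.comp_def, habs] using F.tendsto_M.abs

lemma tendsto_electricPlus (hF : F.Represents B) : Tendsto B.electricPlus atTop (𝓝 0) := by
  have hwedge := (BianchiModel.isBigO_wedge_R1 (B := B) atTop).trans_tendsto hF.tendsto_R1
  simpa using show Tendsto B.electricPlus atTop (𝓝 _) from
    ((hF.tendsto_Sp.add (hF.tendsto_Sp.pow 2)).add
      ((hF.tendsto_R1.sub (hF.tendsto_polarCos.const_mul 3)).div_const 2)).add
      (hF.tendsto_v_zero.mul hwedge)

lemma one_isBigO_Np_mul_R1 (hF : F.Represents B) :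
    (fun _ => (1 : ℝ)) =O[atTop] fun τ => B.Np τ * B.R1 τ := by
  refine .of_bound 1 ?_
  filter_upwards [F.tendsto_X_mul_N.eventually_ge_atTop 1, eventually_gt_atTop τ₀] with τ h ht
  have hN := F.N_pos τ ht
  have hX : 2 * (F.X τ * F.N τ) ≤ F.R τ * F.N τ := by
    rw [← mul_assoc]; gcongr; exact F.two_mul_X_le ht
  rw [norm_one, one_mul, Real.norm_eq_abs, abs_mul, ← hF.abs_N, abs_of_pos hN, ← hF.R_eq,
    mul_comm]
  linarith [le_abs_self (F.R τ), mul_le_mul_of_nonneg_right (le_abs_self (F.R τ)) hN.le]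

lemma isBigO_W1 (hF : F.Represents B) (hB : B.IsRadiationVII0 τ₀) :
    (fun τ => B.W1 τ + 4 * B.Np τ ^ 2 * B.polarCos τ) =O[atTop] fun τ => B.Np τ * B.R1 τ := by
  have hlead : (fun τ => 2 * (1 - 5 * B.Sp τ) * (B.Np τ * B.polarSin τ)) =O[atTop]
      fun τ => B.Np τ * B.R1 τ := by
    simpa using (((hF.tendsto_Sp.const_mul 5).const_sub 1).const_mul 2).isBigO_one ℝ |>.mul
      ((isBigO_refl B.Np atTop).mul (BianchiModel.isBigO_polarSin_R1 atTop))
  have hrest := (((((hF.tendsto_electricPlus.pow 2).sub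
    ((hF.tendsto_polarSin.pow 2).const_mul (9 / 4))).add
      (((((hF.tendsto_Sp.const_mul 2).const_sub 1).pow 2).div_const 2).mul
        (hF.tendsto_R1.add hF.tendsto_polarCos))).sub
      (((hF.tendsto_Sp.pow 2).const_mul (9 / 2)).mul
        (hF.tendsto_R1.sub hF.tendsto_polarCos))).isBigO_one ℝ).trans hF.one_isBigO_Np_mul_R1
  refine (hlead.add hrest).congr' ?_ .rfl
  filter_upwards [eventually_gt_atTop τ₀] with τ ht
  rw [BianchiModel.W1_eq_expansion hB ht]
  ring

lemma isBigO_W2 (hF : F.Represents B) (hB : B.IsRadiationVII0 τ₀) :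
    (fun τ => B.W2 τ + 4 * B.Np τ ^ 2 * B.polarSin τ) =O[atTop] fun τ => B.Np τ * B.R1 τ := by
  have hcoeff := (hF.tendsto_Sp.const_mul 2).const_sub 1
  have hcos := BianchiModel.isBigO_polarCos_R1 (B := B) atTop
  have hbracket : (fun τ => 2 * (1 - 2 * B.Sp τ) * (B.R1 τ + B.polarCos τ) +
      6 * B.Sp τ * (B.R1 τ - B.polarCos τ)) =O[atTop] B.R1 := by
    simpa using (((hcoeff.const_mul 2).isBigO_one ℝ).mul ((isBigO_refl _ _).add hcos)).add
      (((hF.tendsto_Sp.const_mul 6).isBigO_one ℝ).mul ((isBigO_refl _ _).sub hcos))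
  have hrest := ((((hF.tendsto_electricPlus.add (hF.tendsto_Sp.mul hcoeff)).const_mul 3).mul
    hF.tendsto_polarSin).isBigO_one ℝ).trans hF.one_isBigO_Np_mul_R1
  refine (((isBigO_refl B.Np atTop).mul hbracket).add hrest).neg_left.congr' ?_ .rfl
  filter_upwards [eventually_gt_atTop τ₀] with τ ht
  rw [BianchiModel.W2_eq_expansion hB ht]
  ring

section Polar

lemma amplitude_eq (hF : F.Represents B) {τ : ℝ} (h : B.IsPolar R2 ψ τ) (hR2 : 0 < R2 τ) :
    F.amplitude τ = R2 τ := by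
  rw [InvariantFlow.amplitude, hF.A_eq, (sq_eq_sq_iff_abs_eq_abs _ _).2 (hF.abs_C τ), h.sq_add_sq,
    Real.sqrt_sq hR2.le]

lemma tendsto_div_M_sq (hF : F.Represents B) (hpolar : ∀ τ > τ₀, B.IsPolar R2 ψ τ)
    (hR2 : ∀ τ > τ₀, 0 < R2 τ) : Tendsto (fun τ => R2 τ / B.M τ ^ 2) atTop atTop := by
  refine F.tendsto_amplitude_mul_N_sq.congr' ((eventually_gt_atTop τ₀).mono fun τ ht => ?_)
  simp only [BianchiModel.div_M_sq, hF.amplitude_eq (hpolar τ ht) (hR2 τ ht),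
    (sq_eq_sq_iff_abs_eq_abs _ _).2 (hF.abs_N τ)]

lemma isBigO_R1_R2 (hF : F.Represents B) (hpolar : ∀ τ > τ₀, B.IsPolar R2 ψ τ)
    (hR2 : ∀ τ > τ₀, 0 < R2 τ) (h : ¬ Tendsto (fun τ => R2 τ / B.R1 τ) atTop (𝓝 0)) :
    B.R1 =O[atTop] R2 := by
  have hamp : ∀ᶠ τ in atTop, F.amplitude τ = R2 τ :=
    (eventually_gt_atTop τ₀).mono fun τ ht => hF.amplitude_eq (hpolar τ ht) (hR2 τ ht)
  obtain ⟨δ, hδ, hle⟩ := F.exists_mul_R_le_amplitude fun h' =>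
    h (h'.congr' (hamp.mono fun τ hτ => by simp only [hτ, hF.R_eq]))
  refine .of_bound δ⁻¹ ?_
  filter_upwards [hle, hamp, eventually_gt_atTop τ₀] with τ hτ hampτ ht
  rw [hampτ] at hτ
  rw [← hF.R_eq, Real.norm_of_nonneg (F.R_nonneg τ ht), Real.norm_of_nonneg (hR2 τ ht).le,
    inv_mul_eq_div, le_div_iff₀' hδ]
  exact hτ

lemma exists_error_isBigO_M {W p c : ℝ → ℝ} (hF : F.Represents B)
    (hpolar : ∀ τ > τ₀, B.IsPolar R2 ψ τ) (hR2 : ∀ τ > τ₀, 0 < R2 τ)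
    (h : ¬ Tendsto (fun τ => R2 τ / B.R1 τ) atTop (𝓝 0)) (hc : ∀ τ > τ₀, R2 τ * c τ = p τ)
    (hW : (fun τ => W τ + 4 * B.Np τ ^ 2 * p τ) =O[atTop] fun τ => B.Np τ * B.R1 τ) :
    ∃ ε : ℝ → ℝ, ε =O[atTop] B.M ∧
      ∀ᶠ τ in atTop, W τ = -(4 * R2 τ / B.M τ ^ 2) * (c τ + ε τ) := by
  have hK : Tendsto (fun τ => 4 * R2 τ / B.M τ ^ 2) atTop atTop := by
    simpa only [mul_div_assoc] using (hF.tendsto_div_M_sq hpolar hR2).const_mul_atTop four_pos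
  have hR : (fun τ => B.Np τ * B.R1 τ) =O[atTop] fun τ => 4 * R2 τ / B.M τ ^ 2 * B.M τ := by
    refine (((isBigO_refl B.Np atTop).mul (hF.isBigO_R1_R2 hpolar hR2 h)).const_mul_right
      four_ne_zero).congr_right fun τ => ?_
    rw [BianchiModel.div_M_sq, BianchiModel.M, one_div, mul_assoc, sq, mul_self_mul_inv]
    ring
  refine exists_relative_error (hK.eventually_ne_atTop 0) ((hW.trans hR).congr' ?_ .rfl)
  filter_upwards [eventually_gt_atTop τ₀] with τ ht
  rw [BianchiModel.div_M_sq, ← hc τ ht]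
  ring

end Polar

end InvariantFlow.Represents

theorem theorem2 (B : BianchiModel) (τ₀ : ℝ) (hB : B.IsRadiationVII0 τ₀)
    (R2 ψ : ℝ → ℝ) (hpolar : ∀ τ > τ₀, B.IsPolar R2 ψ τ)
    (hΩ : ∀ τ > τ₀, 0 < B.Ω τ) (hR1 : ∀ τ > τ₀, 0 < B.R1 τ)
    (hR2 : ∀ τ > τ₀, 0 < R2 τ) (hv : ∀ τ > τ₀, 0 < B.v τ 0) :
    Tendsto B.Ω atTop (𝓝 1) ∧
    (∀ α, Tendsto (fun τ => B.v τ α) atTop (𝓝 0)) ∧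
    Tendsto B.shear atTop (𝓝 0) ∧
    Tendsto B.M atTop (𝓝 0) ∧
    Tendsto (fun τ => R2 τ / B.M τ ^ 2) atTop atTop ∧
    (¬ Tendsto (fun τ => R2 τ / B.R1 τ) atTop (𝓝 0) →
      (∃ ε₁ ε₂ : ℝ → ℝ, ε₁ =O[atTop] B.M ∧ ε₂ =O[atTop] B.M ∧
        ∀ᶠ τ in atTop,
          B.W1 τ = -(4 * R2 τ / B.M τ ^ 2) * (Real.cos (2 * ψ τ) + ε₁ τ) ∧
          B.W2 τ = -(4 * R2 τ / B.M τ ^ 2) * (Real.sin (2 * ψ τ) + ε₂ τ)) ∧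
      Tendsto (fun τ => √(B.W1 τ ^ 2 + B.W2 τ ^ 2)) atTop atTop) := by
  obtain ⟨F, hF⟩ := BianchiModel.exists_represents hB hΩ hv
  have hM := hF.tendsto_M
  have hK := hF.tendsto_div_M_sq hpolar hR2
  refine ⟨hF.tendsto_Ω hB, hF.tendsto_v hB, hF.tendsto_shear hB, hM, hK, fun h => ?_⟩
  obtain ⟨ε₁, hε₁, hW₁⟩ := hF.exists_error_isBigO_M hpolar hR2 h
    (fun τ hτ => (hpolar τ hτ).1) (hF.isBigO_W1 hB)
  obtain ⟨ε₂, hε₂, hW₂⟩ := hF.exists_error_isBigO_M hpolar hR2 h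
    (fun τ hτ => (hpolar τ hτ).2) (hF.isBigO_W2 hB)
  refine ⟨⟨ε₁, ε₂, hε₁, hε₂, hW₁.and hW₂⟩, ?_⟩
  have hK' : Tendsto (fun τ => 4 * R2 τ / B.M τ ^ 2) atTop atTop := by
    simpa only [mul_div_assoc] using hK.const_mul_atTop four_pos
  exact tendsto_sqrt_sq_add_sq_atTop hK' (hε₁.trans_tendsto hM) (hε₂.trans_tendsto hM) hW₁ hW₂
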